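/- Let $1\le s\le\min\{m,n\}$, $R\ge 0$, and let $\mathcal K=\{X\in\mathbb R^{m\times n}:\|X\|_1\le R\}$, where $\|\cdot\|_1$ is the nuclear norm, $\|\cdot\|_{\mathrm{op}}$ the operator norm and $\|\cdot\|_2$ the Euclidean (Frobenius) norm. Let $f$ be convex on $\mathcal K$ and differentiable at the points of $\mathcal K$, with $\|\nabla f(X)-\nabla f(Y)\|_{\mathrm{op}}\le\beta_1\|X-Y\|_1$ for $X,Y\in\mathcal K$, where $\beta_1>0$. Let $f^*$ be the minimum of $f$ over $\mathcal K$ and $\mathcal X^*$ the set of minimizers, and suppose that $\min_{X^*\in\mathcal X^*}\|X-X^*\|_2^2\le\frac{2}{\alpha_2}(f(X)-f^*)$ for all $X\in\mathcal K$, where $\alpha_2>0$. Assume that every $X^*\in\mathcal X^*$ satisfies $\mathrm{rank}(X^*)\le s$ and $\|X^*\|_1=R$. Put $\mathbb E_s=\{X:\mathrm{rank}(X)\le s\}$ and $\mathcal K_s=\mathcal K\cap\mathbb E_s$. (1) With $s^*_{\mathcal K}=8s$: the set $\mathbb E_s$ is closed, $\mathcal X^*\subseteq\mathcal K_s$, $s,s^*_{\mathcal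 K}\ge1$; $\|X-Y\|_1\le\sqrt{2s}\,\|X-Y\|_2$ for all $X,Y\in\mathbb E_s$; $\|X-X^*\|_1\le\sqrt{s^*_{\mathcal K}}\,\|X-X^*\|_2$ for all $X\in\mathcal K$, $X^*\in\mathcal X^*$; and $\arg\min_{Y\in\mathbb E_s}\|Y-X\|_1=\arg\min_{Y\in\mathbb E_s}\|Y-X\|_2$ (as sets) for all $X\in\mathcal K$. Let $\eta=\frac{\alpha_2}{4\beta_1(8s+s^*_{\mathcal K})}=\frac{\alpha_2}{64\beta_1 s}$ and suppose $\eta\le1$ (which can always be achieved by increasing $\beta_1$). Consider the algorithm that starts at an arbitrary $X_0\in\mathcal K$ and in iteration $k=0,1,2,\dots$ computes $\widehat X_k\in\arg\min_{Y\in\mathbb E_s}\|Y-X_k\|_2$, then $V_k\in\arg\min_{V\in\mathcal K_s}\langle V-X_k,\nabla f(X_k)\rangle+2s\beta_1\eta\|V-\widehat X_k\|_2^2$, and sets $X_{k+1}=(1-\gamma_k)X_k+\gamma_kV_k$, where either $\gamma_k=\eta$ or $\gamma_k\in\arg\min_{\gamma\in[0,1]}f((1-\gamma)X_k+\gamma V_k)$.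 (2) There is an absolute constant $C_1$ such that every run of the algorithm satisfies, for every $\epsilon>0$, $f(X_k)-f^*\le\epsilon$ for all $k\ge C_1\frac{\beta_1s}{\alpha_2}\log\frac{f(X_0)-f^*}{\epsilon}$ (for all $k\ge 0$ if $f(X_0)=f^*$). In particular, if $\epsilon\,(f(X_0)-f^*)\le1$, this holds for all $k\ge C_1\frac{\beta_1s}{\alpha_2}\log\frac1\epsilon$. (3) There are an absolute constant $C_2$ and a single program for a real random access machine with oracles for $\nabla f$ and for rank-$s$ SVDs of $m\times n$ matrices (which return the $s$ top components of some SVD) that implements the algorithm with $\gamma_k=\eta$, uniformly in $m,n,s$ and the problem data: for every such oracle and every $X_0\in\mathcal K$, each iteration uses one gradient evaluation, two rank-$s$ SVDs, and at most $C_2\,smn$ further elementary operations (real arithmetic, comparisons, loop steps), i.e. further work of the order of $s$ products of an $m\times n$ matrix with a vector; apart from the gradient, the iteration is in this sense dominated by the two SVDs. -/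

import Mathlib

open Set

noncomputable section

namespace SparseFW

/-! ### Matrices, norms, and the constrained problem -/

/-- The space of real `m × n` matrices. -/
abbrev Mat (m n : ℕ) : Type := Matrix (Fin m) (Fin n) ℝ

/-- The Euclidean (trace) inner product of two matrices. -/
def dot {m n : ℕ} (A B : Mat m n) : ℝ := ∑ i, ∑ j, A i j * B i j

/-- The Euclidean (Frobenius) norm. -/
def frobNorm {m n : ℕ} (A : Mat m n) : ℝ := Real.sqrt (dot A A)

/-- The nuclear norm: the sum of the `min m n` singular values. -/
def nuclearNorm {m n : ℕ} (A : Mat m n) : ℝ :=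
  ∑ i ∈ Finset.range (min m n), (Matrix.toEuclideanLin A).singularValues i

/-- The operator (spectral) norm, i.e. the norm of `x ↦ A x` between Euclidean spaces. -/
def opNorm {m n : ℕ} (A : Mat m n) : ℝ :=
  ‖LinearMap.toContinuousLinearMap (Matrix.toEuclideanLin A)‖

/-- The nuclear norm ball of radius `R`. -/
def nuclearBall (m n : ℕ) (R : ℝ) : Set (Mat m n) := {X | nuclearNorm X ≤ R}

/-- The matrices of rank at most `s`. -/
def lowRank (m n s : ℕ) : Set (Mat m n) := {X | X.rank ≤ s}

/-- The set of minimizers of `φ` over `S`. -/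
def argminOn {E : Type*} (φ : E → ℝ) (S : Set E) : Set E := {y | y ∈ S ∧ ∀ z ∈ S, φ y ≤ φ z}

/-- The optimal value of `f` over `K` (used only where `f` attains its minimum over `K`). -/
def optVal {E : Type*} (f : E → ℝ) (K : Set E) : ℝ := sInf (f '' K)

/-- `G` is the gradient of `f` at `X` with respect to the trace inner product. -/
def IsGradientAt {m n : ℕ} (f : Mat m n → ℝ) (G X : Mat m n) : Prop :=
  ∃ L : Mat m n →L[ℝ] ℝ, (∀ H, L H = dot G H) ∧ HasFDerivAt f L X

/-- The nuclear-norm-constrained problem `min {f X : ‖X‖₁ ≤ R}` with its standing assumptions: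
`f` is convex over the ball with gradient `g`, which is `β`-Lipschitz from the nuclear norm to its
dual norm; quadratic growth holds with constant `α₂` in the Euclidean norm; every optimal solution
has rank at most `s` and nuclear norm exactly `R`. -/
structure NuclearProblem {m n : ℕ} (s : ℕ) (f : Mat m n → ℝ) (g : Mat m n → Mat m n)
    (R β α₂ : ℝ) : Prop where
  one_le_s : 1 ≤ s
  s_le : s ≤ min m n
  R_nonneg : 0 ≤ R
  β_pos : 0 < β
  α₂_pos : 0 < α₂
  convex : ConvexOn ℝ (nuclearBall m n R) f
  gradient : ∀ X ∈ nuclearBall m n R, IsGradientAt f (g X) X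
  lipschitz : ∀ X ∈ nuclearBall m n R, ∀ Y ∈ nuclearBall m n R,
    opNorm (g X - g Y) ≤ β * nuclearNorm (X - Y)
  growth : ∀ X ∈ nuclearBall m n R, ∃ Xs ∈ argminOn f (nuclearBall m n R),
    frobNorm (X - Xs) ^ 2 ≤ 2 / α₂ * (f X - f Xs)
  rank_opt : ∀ Xs ∈ argminOn f (nuclearBall m n R), Xs.rank ≤ s
  tight_opt : ∀ Xs ∈ argminOn f (nuclearBall m n R), nuclearNorm Xs = R

/-! ### The structural assumption on norm, feasible set and sparse set -/

/-- Norm `N`, Euclidean norm `N₂`, feasible set `K`, set of optimal solutions `Xopt`, sparse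
set `Es`, and scalars `s`, `sK`. -/
structure SparsityAssumption {E : Type*} [AddCommGroup E] [TopologicalSpace E]
    (N N₂ : E → ℝ) (K Xopt Es : Set E) (s sK : ℝ) : Prop where
  closed : IsClosed Es
  opt_subset : Xopt ⊆ K ∩ Es
  one_le_s : 1 ≤ s
  one_le_sK : 1 ≤ sK
  norm_le_sparse : ∀ x ∈ Es, ∀ y ∈ Es, N (x - y) ≤ Real.sqrt (2 * s) * N₂ (x - y)
  norm_le_opt : ∀ x ∈ K, ∀ xs ∈ Xopt, N (x - xs) ≤ Real.sqrt sK * N₂ (x - xs)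
  argmin_eq : ∀ x ∈ K, argminOn (fun y => N (y - x)) Es = argminOn (fun y => N₂ (y - x)) Es

/-! ### The algorithm -/

/-- Frank-Wolfe with a sparse proximal oracle and hard-thresholding, over the feasible set `K` with
sparse set `Es`. The iterate `x k` is the one obtained after `k` iterations; any choice among
several minimizers is allowed. -/
structure IsRun {m n : ℕ} (g : Mat m n → Mat m n) (K Es : Set (Mat m n)) (s β η : ℝ)
    (x xhat v : ℕ → Mat m n) (γ : ℕ → ℝ) : Prop where
  init : x 0 ∈ K
  threshold : ∀ k, xhat k ∈ argminOn (fun y => frobNorm (y - x k)) Es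
  prox : ∀ k, v k ∈ argminOn
    (fun w => dot (w - x k) (g (x k)) + 2 * s * β * η * frobNorm (w - xhat k) ^ 2) (K ∩ Es)
  step_mem : ∀ k, γ k ∈ Icc (0 : ℝ) 1
  update : ∀ k, x (k + 1) = (1 - γ k) • x k + γ k • v k

/-- In each iteration the step is either the pre-defined value `η` or found by line-search. -/
def StepRule {m n : ℕ} (f : Mat m n → ℝ) (η : ℝ) (x v : ℕ → Mat m n) (γ : ℕ → ℝ) : Prop :=
  ∀ k, γ k = η ∨ γ k ∈ argminOn (fun c : ℝ => f ((1 - c) • x k + c • v k)) (Icc (0 : ℝ) 1)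

/-- The step-size `α₂ / (4 β (8 s + sK))`. -/
def stepSize (s sK β α₂ : ℝ) : ℝ := α₂ / (4 * β * (8 * s + sK))

/-! ### Rank-`s` singular value decompositions -/

/-- Left singular vectors (columns of `U`), singular values and right singular vectors (columns
of `V`). -/
structure SVDData (m n s : ℕ) where
  U : Mat m s
  σ : Fin s → ℝ
  V : Mat n s

/-- `D` is a singular value decomposition of `Z` with all `min m n` components, the singular values
in non-increasing order. -/
structure IsFullSVD {m n : ℕ} (Z : Mat m n) (D : SVDData m n (min m n)) : Prop where
  orthoU : D.U.transpose * D.U = 1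
  orthoV : D.V.transpose * D.V = 1
  nonneg : ∀ i, 0 ≤ D.σ i
  anti : Antitone D.σ
  eq : Z = D.U * Matrix.diagonal D.σ * D.V.transpose

/-- `D` consists of the `s` top components of some singular value decomposition of `Z`. -/
def IsTopSVD {m n s : ℕ} (hs : s ≤ min m n) (Z : Mat m n) (D : SVDData m n s) : Prop :=
  ∃ F : SVDData m n (min m n), IsFullSVD Z F ∧
    (∀ i j, D.U i j = F.U i (Fin.castLE hs j)) ∧
    (∀ j, D.σ j = F.σ (Fin.castLE hs j)) ∧
    (∀ i j, D.V i j = F.V i (Fin.castLE hs j))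

/-! ### A real random access machine with a gradient oracle and a rank-`s` SVD oracle

The memory consists of two-dimensional arrays of real numbers, named by natural numbers. A program
is a fixed text, independent of the dimensions and of the data: it can do real arithmetic, compare
two cells, loop over `0, …, d - 1` where `d` is one of `m`, `n`, `s`, and call the two oracles on
whole arrays. Every elementary instruction costs one operation; oracle calls are counted
separately. -/

/-- Memory: array name, row, column. -/
abbrev Memory : Type := ℕ → ℕ → ℕ → ℝ

/-- A row or column index: the current value of a loop variable, or a literal. -/
inductive Idx where
  | var (v : ℕ)
  | lit (c : ℕ)

/-- A memory cell. -/
structure Cell where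
  arr : ℕ
  row : Idx
  col : Idx

/-- Loop bounds: `m`, `n` and `s`. -/
inductive Bound where
  | rows
  | cols
  | rank

/-- Real arithmetic. -/
inductive Arith where
  | add
  | sub
  | mul
  | div

/-- Programs. -/
inductive Prog where
  | skip
  | const (dst : Cell) (c : ℤ)
  | arith (o : Arith) (dst a b : Cell)
  | seq (p q : Prog)
  | ifLE (a b : Cell) (p q : Prog)
  | loop (v : ℕ) (d : Bound) (body : Prog)
  | grad (src dst : ℕ)
  | svd (src dstU dstσ dstV : ℕ)

/-- Machine state: memory and the numbers of elementary operations, gradient calls and SVD calls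
so far. -/
structure State where
  mem : Memory
  ops : ℕ
  grads : ℕ
  svds : ℕ

def Idx.val (env : ℕ → ℕ) : Idx → ℕ
  | .var v => env v
  | .lit c => c

def Bound.val (m n s : ℕ) : Bound → ℕ
  | .rows => m
  | .cols => n
  | .rank => s

def Arith.val : Arith → ℝ → ℝ → ℝ
  | .add, a, b => a + b
  | .sub, a, b => a - b
  | .mul, a, b => a * b
  | .div, a, b => a / b

def readCell (env : ℕ → ℕ) (mem : Memory) (c : Cell) : ℝ :=
  mem c.arr (c.row.val env) (c.col.val env)

def writeCell (env : ℕ → ℕ) (mem : Memory) (c : Cell) (r : ℝ) : Memory := fun a i j =>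
  if a = c.arr ∧ i = c.row.val env ∧ j = c.col.val env then r else mem a i j

/-- The leading `p × q` block of array `a`. -/
def readMat (p q : ℕ) (mem : Memory) (a : ℕ) : Mat p q := fun i j => mem a i j

/-- Overwrite the leading `p × q` block of array `a`. -/
def writeMat {p q : ℕ} (mem : Memory) (a : ℕ) (M : Mat p q) : Memory := fun b i j =>
  if h : i < p ∧ j < q then (if b = a then M ⟨i, h.1⟩ ⟨j, h.2⟩ else mem b i j) else mem b i j

/-- Write a rank-`s` SVD into three arrays; the singular values go into row `0`. -/
def writeSVD {m n s : ℕ} (mem : Memory) (aU aσ aV : ℕ) (D : SVDData m n s) : Memory :=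
  writeMat (writeMat (writeMat mem aU D.U) aσ (fun (_ : Fin 1) j => D.σ j)) aV D.V

/-- Execution, with `env` holding the values of the loop variables. -/
def Prog.exec {m n s : ℕ} (g : Mat m n → Mat m n) (svdOracle : Mat m n → SVDData m n s) :
    Prog → (ℕ → ℕ) → State → State
  | .skip, _, st => st
  | .const dst c, env, st =>
      { st with mem := writeCell env st.mem dst (c : ℝ), ops := st.ops + 1 }
  | .arith o dst a b, env, st =>
      { st with
        mem := writeCell env st.mem dst (o.val (readCell env st.mem a) (readCell env st.mem b))
        ops := st.ops + 1 }
  | .seq p q, env, st => q.exec g svdOracle env (p.exec g svdOracle env st)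
  | .ifLE a b p q, env, st =>
      if readCell env st.mem a ≤ readCell env st.mem b
      then p.exec g svdOracle env { st with ops := st.ops + 1 }
      else q.exec g svdOracle env { st with ops := st.ops + 1 }
  | .loop v d body, env, st =>
      (List.range (d.val m n s)).foldl
        (fun st' k => body.exec g svdOracle (Function.update env v k)
          { st' with ops := st'.ops + 1 })
        { st with ops := st.ops + 1 }
  | .grad src dst, _, st =>
      { st with
        mem := writeMat st.mem dst (g (readMat m n st.mem src))
        grads := st.grads + 1 }
  | .svd src aU aσ aV, _, st =>
      { st with
        mem := writeSVD st.mem aU aσ aV (svdOracle (readMat m n st.mem src))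
        svds := st.svds + 1 }

/-- One execution of the program, started with the counters at zero. -/
def Prog.run {m n s : ℕ} (g : Mat m n → Mat m n) (svdOracle : Mat m n → SVDData m n s)
    (p : Prog) (mem : Memory) : State :=
  p.exec g svdOracle (fun _ => 0) ⟨mem, 0, 0, 0⟩

/-- The memory after `k` executions of the program. -/
def Prog.memAfter {m n s : ℕ} (g : Mat m n → Mat m n) (svdOracle : Mat m n → SVDData m n s)
    (p : Prog) (mem : Memory) (k : ℕ) : Memory :=
  (fun μ => (p.run g svdOracle μ).mem)^[k] mem

/-- The input: array `0` holds the matrix `X`, array `1` holds the parameters `R, s, β, η`; all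
other cells are arbitrary. -/
def Loaded {m n : ℕ} (mem : Memory) (X : Mat m n) (R s β η : ℝ) : Prop :=
  readMat m n mem 0 = X ∧ mem 1 0 0 = R ∧ mem 1 0 1 = s ∧ mem 1 0 2 = β ∧ mem 1 0 3 = η

end SparseFW

end

/-!
# Sparse Frank-Wolfe for nuclear-norm-constrained problems

**Linear algebra.** Everything is reduced to Weyl's inequality `σ_{i+s}(X) ≤ σ_i(X - Y)` for
`rank Y ≤ s` (`sv_add_le_sv_sub`), obtained by intersecting a subspace on which a map expands with
one on which another contracts, and to the duality between the operator and the nuclear norm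
(`dot_le_opNorm_mul_nuclearNorm`, `exists_dot_eq_nuclearNorm`). A matrix of rank at most `s` is a
best approximation of `X`, in the Euclidean or in the nuclear norm, exactly if all of Weyl's
inequalities are equalities, so the two sets of best approximations agree
(`mem_argminOn_frobNorm_iff`, `mem_argminOn_nuclearNorm_iff`). The bound
`‖X - X*‖₁ ≤ √(8 s) ‖X - X*‖₂` (`nuclearNorm_sub_le_of_le`) is the cone condition of low-rank
recovery: pairing `X` with a subgradient of the nuclear norm at `X*` shows that the part of
`X - X*` outside the tangent space at `X*` has at most the nuclear norm of the part inside, whose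
rank is at most `2 s`.

**Convergence.** The descent lemma, the optimality of `V` against a nearby optimal solution, and
quadratic growth give `h_{k+1} ≤ (1 - η / 2) h_k` for the optimality gap `h_k`
(`NuclearProblem.step_contraction`). With `η = α₂ / (64 β s)` this is
`h_k ≤ h_0 exp (- α₂ k / (128 β s))`; the constant `256` leaves room for the variant of the bound
in which `h_0` is only controlled by `1 / ε`.

**Implementation.** Completing the square turns the proximal step into the Euclidean projection of
`Z = X̂ - ∇f / (4 s β η)` onto the matrices of rank at most `s` in the nuclear norm ball. The
projection keeps `s` singular values of `Z` and soft-thresholds them at the level `τ` that projects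
them onto `{p ≥ 0, ∑ p ≤ R}` (`IsFullSVD.dot_projection_le`). For sorted values,
`τ = max (0, max_j (σ_0 + ⋯ + σ_{j-1} - R) / j)`, which a linear scan computes
(`IsScanLevel.sum_max`). The remaining work is dominated by forming two products `U diag(σ) Vᵀ`, at
`O(s m n)` operations each.
-/

namespace SparseFW

/-! ### Singular values of linear maps: min-max characterization and Weyl's inequality -/

section LinearMaps

open Module

variable {E F : Type*} [NormedAddCommGroup E] [InnerProductSpace ℝ E]
  [NormedAddCommGroup F] [InnerProductSpace ℝ F]

/-- `T` expands lengths by at least `c` on some subspace of dimension greater than `i`. -/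
def ExpandsOn (T : E →ₗ[ℝ] F) (i : ℕ) (c : ℝ) : Prop :=
  ∃ S : Submodule ℝ E, i < finrank ℝ S ∧ ∀ x ∈ S, c * ‖x‖ ≤ ‖T x‖

/-- `T` expands lengths by at most `c` on some subspace of codimension at most `i`. -/
def ContractsOn (T : E →ₗ[ℝ] F) (i : ℕ) (c : ℝ) : Prop :=
  ∃ S : Submodule ℝ E, finrank ℝ E ≤ finrank ℝ S + i ∧ ∀ x ∈ S, ‖T x‖ ≤ c * ‖x‖

/-- The right half of a singular value decomposition: `T` maps the orthonormal system `v` to an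
orthogonal system with lengths `σ`, and vanishes on its orthogonal complement; this is expressed
through the quadratic form `‖T x‖²`. -/
structure IsRightSVD {k : ℕ} (T : E →ₗ[ℝ] F) (σ : Fin k → ℝ) (v : Fin k → E) : Prop where
  ortho : Orthonormal ℝ v
  anti : Antitone σ
  nonneg : ∀ i, 0 ≤ σ i
  norm_sq : ∀ x, ‖T x‖ ^ 2 = ∑ j, σ j ^ 2 * inner ℝ (v j) x ^ 2

/-- On the span of `v 0, …, v i`, lengths grow by at least `σ i`. -/
theorem IsRightSVD.expandsOn {k : ℕ} {T : E →ₗ[ℝ] F} {σ : Fin k → ℝ} {v : Fin k → E}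
    (h : IsRightSVD T σ v) (i : Fin k) : ExpandsOn T i (σ i) := by
  let w : Fin (i + 1) → E := fun j => v (Fin.castLE i.isLt j)
  have hw : Orthonormal ℝ w := h.ortho.comp _ (Fin.castLE_injective _)
  refine ⟨Submodule.span ℝ (range w), ?_, fun x hx => ?_⟩
  · rw [finrank_span_eq_card hw.linearIndependent]
    simp
  · obtain ⟨a, rfl⟩ := (Submodule.mem_span_range_iff_exists_fun ℝ).mp hx
    have hnorm : ‖∑ j, a j • w j‖ ^ 2 = ∑ j, a j ^ 2 := by
      rw [← real_inner_self_eq_norm_sq, hw.inner_sum]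
      simp [sq]
    refine le_of_sq_le_sq ?_ (norm_nonneg _)
    rw [mul_pow, hnorm, h.norm_sq, Finset.mul_sum]
    calc ∑ j, σ i ^ 2 * a j ^ 2
        ≤ ∑ j : Fin (i + 1), σ (Fin.castLE i.isLt j) ^ 2 *
            inner ℝ (v (Fin.castLE i.isLt j)) (∑ l, a l • w l) ^ 2 := by
          refine Finset.sum_le_sum fun j _ => ?_
          have e : inner ℝ (v (Fin.castLE i.isLt j)) (∑ l, a l • w l) = a j :=
            hw.inner_right_fintype a j
          rw [e]
          refine mul_le_mul_of_nonneg_right ?_ (sq_nonneg _)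
          refine pow_le_pow_left₀ (h.nonneg i) (h.anti ?_) 2
          exact Fin.le_def.mpr (Nat.lt_succ_iff.mp j.isLt)
      _ = ∑ j ∈ Finset.univ.map ⟨Fin.castLE i.isLt, Fin.castLE_injective _⟩,
            σ j ^ 2 * inner ℝ (v j) (∑ l, a l • w l) ^ 2 := by
          rw [Finset.sum_map]; rfl
      _ ≤ ∑ j, σ j ^ 2 * inner ℝ (v j) (∑ l, a l • w l) ^ 2 :=
          Finset.sum_le_sum_of_subset_of_nonneg (Finset.subset_univ _)
            fun _ _ _ => by positivity

variable [FiniteDimensional ℝ E]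

theorem finrank_add_le_finrank_inf (S T : Submodule ℝ E) :
    finrank ℝ S + finrank ℝ T ≤ finrank ℝ E + finrank ℝ (S ⊓ T : Submodule ℝ E) := by
  have h := Submodule.finrank_sup_add_finrank_inf_eq S T
  have h' := Submodule.finrank_le (S ⊔ T)
  omega

theorem ExpandsOn.le {T : E →ₗ[ℝ] F} {i : ℕ} {c d : ℝ} (h : ExpandsOn T i c)
    (h' : ContractsOn T i d) : c ≤ d := by
  obtain ⟨S, hS, hc⟩ := h
  obtain ⟨S', hS', hd⟩ := h'
  have hdim := finrank_add_le_finrank_inf S S'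
  have hne : (S ⊓ S' : Submodule ℝ E) ≠ ⊥ := by
    intro h0
    rw [h0, finrank_bot] at hdim
    omega
  obtain ⟨x, hx, hx0⟩ := Submodule.exists_mem_ne_zero_of_ne_bot hne
  have hpos : 0 < ‖x‖ := norm_pos_iff.mpr hx0
  exact le_of_mul_le_mul_right ((hc x hx.1).trans (hd x hx.2)) hpos

theorem ContractsOn.add {T T' : E →ₗ[ℝ] F} {i j : ℕ} {c d : ℝ} (h : ContractsOn T i c)
    (h' : ContractsOn T' j d) : ContractsOn (T + T') (i + j) (c + d) := by
  obtain ⟨S, hS, hc⟩ := h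
  obtain ⟨S', hS', hd⟩ := h'
  refine ⟨S ⊓ S', ?_, fun x hx => ?_⟩
  · have hdim := finrank_add_le_finrank_inf S S'
    omega
  · calc ‖(T + T') x‖ ≤ ‖T x‖ + ‖T' x‖ := norm_add_le _ _
      _ ≤ (c + d) * ‖x‖ := by
        rw [add_mul]; exact add_le_add (hc x hx.1) (hd x hx.2)

theorem contractsOn_zero_of_finrank_range_le {T : E →ₗ[ℝ] F} {r : ℕ}
    (h : finrank ℝ (LinearMap.range T) ≤ r) : ContractsOn T r 0 := by
  refine ⟨LinearMap.ker T, ?_, fun x hx => ?_⟩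
  · have := T.finrank_range_add_finrank_ker
    omega
  · simp [LinearMap.mem_ker.mp hx]

/-- On the orthogonal complement of `v 0, …, v (i - 1)`, lengths grow by at most `σ i`. -/
theorem IsRightSVD.contractsOn {k : ℕ} {T : E →ₗ[ℝ] F} {σ : Fin k → ℝ} {v : Fin k → E}
    (h : IsRightSVD T σ v) (i : ℕ) :
    ContractsOn T i (if hi : i < k then σ ⟨i, hi⟩ else 0) := by
  set c : ℝ := if hi : i < k then σ ⟨i, hi⟩ else 0 with hc
  have hc0 : 0 ≤ c := by
    rw [hc]; split_ifs with hi
    exacts [h.nonneg _, le_rfl]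
  let w : {j : Fin k // (j : ℕ) < i} → E := fun j => v j
  have hcard : Fintype.card {j : Fin k // (j : ℕ) < i} ≤ i := by
    simpa using Fintype.card_le_of_injective
      (fun j : {j : Fin k // (j : ℕ) < i} => (⟨j.1, j.2⟩ : Fin i))
      (fun a b hab => Subtype.ext (Fin.ext (by simpa using hab)))
  refine ⟨(Submodule.span ℝ (range w))ᗮ, ?_, fun x hx => ?_⟩
  · have h1 := Submodule.finrank_add_finrank_orthogonal (Submodule.span ℝ (range w))
    have h2 : finrank ℝ (Submodule.span ℝ (range w)) ≤ _ := finrank_range_le_card (R := ℝ) w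
    omega
  · have h0 : ∀ j : Fin k, (j : ℕ) < i → inner ℝ (v j) x = 0 := fun j hj =>
      (Submodule.mem_orthogonal _ x).mp hx _ (Submodule.subset_span ⟨⟨j, hj⟩, rfl⟩)
    refine le_of_sq_le_sq ?_ (by positivity)
    rw [h.norm_sq, mul_pow]
    calc ∑ j, σ j ^ 2 * inner ℝ (v j) x ^ 2
        ≤ ∑ j, c ^ 2 * inner ℝ (v j) x ^ 2 := by
          refine Finset.sum_le_sum fun j _ => ?_
          by_cases hj : (j : ℕ) < i
          · simp [h0 j hj]
          · have hi : i < k := by omega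
            refine mul_le_mul_of_nonneg_right (pow_le_pow_left₀ (h.nonneg j) ?_ 2) (sq_nonneg _)
            rw [hc, dif_pos hi]
            exact h.anti (Fin.le_def.mpr (by simpa using hj))
      _ = c ^ 2 * ∑ j, inner ℝ (v j) x ^ 2 := by rw [Finset.mul_sum]
      _ ≤ c ^ 2 * ‖x‖ ^ 2 := by
          refine mul_le_mul_of_nonneg_left ?_ (sq_nonneg c)
          simpa using h.ortho.sum_inner_products_le x (s := Finset.univ)

variable [FiniteDimensional ℝ F]

/-- The eigenvectors of `T* T`, with the singular values of `T`, form a right SVD. -/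
theorem exists_isRightSVD (T : E →ₗ[ℝ] F) {n : ℕ} (hn : finrank ℝ E = n) :
    ∃ v : OrthonormalBasis (Fin n) ℝ E,
      IsRightSVD T (fun i : Fin n => T.singularValues i) v ∧
      ∀ i j, inner ℝ (T (v i)) (T (v j)) = if i = j then T.singularValues i ^ 2 else 0 := by
  set hT := T.isSymmetric_adjoint_comp_self
  set v := hT.eigenvectorBasis hn with hv
  have hip : ∀ i j, inner ℝ (T (v i)) (T (v j)) =
      if i = j then T.singularValues i ^ 2 else 0 := by
    intro i j
    rw [← LinearMap.adjoint_inner_left, ← LinearMap.comp_apply, hT.apply_eigenvectorBasis hn i,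
      ← T.sq_singularValues_fin hn i, inner_smul_left, ← hv,
      orthonormal_iff_ite.mp v.orthonormal i j]
    simp
  refine ⟨v, ⟨v.orthonormal, fun i j hij => T.singularValues_antitone hij,
    fun i => T.singularValues_nonneg i, fun x => ?_⟩, hip⟩
  conv_lhs => rw [← v.sum_repr' x, map_sum, ← real_inner_self_eq_norm_sq]
  simp only [map_smul, sum_inner, inner_sum, inner_smul_left, inner_smul_right, hip]
  refine Finset.sum_congr rfl fun j _ => ?_
  simp [sq]
  ring

theorem expandsOn_singularValues (T : E →ₗ[ℝ] F) {i : ℕ} (hi : i < finrank ℝ E) :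
    ExpandsOn T i (T.singularValues i) := by
  obtain ⟨v, hv, -⟩ := exists_isRightSVD T rfl
  exact hv.expandsOn ⟨i, hi⟩

theorem contractsOn_singularValues (T : E →ₗ[ℝ] F) (i : ℕ) :
    ContractsOn T i (T.singularValues i) := by
  obtain ⟨v, hv, -⟩ := exists_isRightSVD T rfl
  have h := hv.contractsOn i
  split_ifs at h with hi
  · exact h
  · rwa [T.singularValues_of_finrank_le (not_lt.mp hi)]

/-- Singular values are determined by any singular value decomposition. -/
theorem IsRightSVD.singularValues_eq {k : ℕ} {T : E →ₗ[ℝ] F} {σ : Fin k → ℝ} {v : Fin k → E}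
    (h : IsRightSVD T σ v) (i : Fin k) : T.singularValues i = σ i := by
  have hc := h.contractsOn i
  rw [dif_pos i.isLt] at hc
  have hk : k ≤ finrank ℝ E := by
    simpa using h.ortho.linearIndependent.fintype_card_le_finrank
  exact le_antisymm ((expandsOn_singularValues T (i.isLt.trans_le hk)).le hc)
    ((h.expandsOn i).le (contractsOn_singularValues T i))

/-- Weyl's inequality for a perturbation of rank at most `r`. -/
theorem singularValues_add_le {T S : E →ₗ[ℝ] F} {r : ℕ}
    (hS : finrank ℝ (LinearMap.range S) ≤ r) (i : ℕ) :
    (T + S).singularValues (i + r) ≤ T.singularValues i := by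
  by_cases hi : i + r < finrank ℝ E
  · have h := (contractsOn_singularValues T i).add (contractsOn_zero_of_finrank_range_le hS)
    rw [add_zero] at h
    exact (expandsOn_singularValues (T + S) hi).le h
  · rw [LinearMap.singularValues_of_finrank_le _ (not_lt.mp hi)]
    exact T.singularValues_nonneg i

/-- Every linear map has a full singular value decomposition. -/
theorem exists_orthonormalBasis_svd (T : E →ₗ[ℝ] F) {m n : ℕ} (hm : finrank ℝ F = m)
    (hn : finrank ℝ E = n) :
    ∃ (u : OrthonormalBasis (Fin m) ℝ F) (v : OrthonormalBasis (Fin n) ℝ E), ∀ j : Fin n,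
      T (v j) = if h : (j : ℕ) < m then T.singularValues j • u ⟨j, h⟩ else 0 := by
  obtain ⟨v, -, hip⟩ := exists_isRightSVD T hn
  set σ := T.singularValues
  have hr : finrank ℝ (LinearMap.range T) ≤ m := hm ▸ Submodule.finrank_le _
  have hrn : finrank ℝ (LinearMap.range T) ≤ n := hn ▸ T.finrank_range_le
  have hzero : ∀ j : Fin n, σ j = 0 → T (v j) = 0 := fun j hj => by
    have := hip j j
    rw [if_pos rfl] at this
    rwa [hj, zero_pow two_ne_zero, inner_self_eq_zero] at this
  let s : Set (Fin m) := {i | (i : ℕ) < finrank ℝ (LinearMap.range T)}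
  let w : Fin m → F := fun i => if h : (i : ℕ) < n then (σ i)⁻¹ • T (v ⟨i, h⟩) else 0
  have hw : Orthonormal ℝ (s.domRestrict w) := by
    rw [orthonormal_iff_ite]
    rintro ⟨i, hi⟩ ⟨j, hj⟩
    have hi' : (i : ℕ) < n := lt_of_lt_of_le hi hrn
    have hj' : (j : ℕ) < n := lt_of_lt_of_le hj hrn
    have hσ : σ i ≠ 0 := (T.singularValues_pos_iff_lt_finrank_range.mpr hi).ne'
    simp only [domRestrict_apply, w, dif_pos hi', dif_pos hj', inner_smul_left, inner_smul_right,
      hip, Subtype.mk.injEq, Fin.mk.injEq, ← Fin.ext_iff]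
    split_ifs with hij
    · subst hij
      simp only [conj_trivial]
      field_simp
    · simp
  obtain ⟨u, hu⟩ := hw.exists_orthonormalBasis_extension_of_card_eq (by simpa using hm)
  refine ⟨u, v, fun j => ?_⟩
  by_cases hj : (j : ℕ) < finrank ℝ (LinearMap.range T)
  · have hjm : (j : ℕ) < m := hj.trans_le hr
    have hσ : σ j ≠ 0 := (T.singularValues_pos_iff_lt_finrank_range.mpr hj).ne'
    rw [dif_pos hjm, hu ⟨j, hjm⟩ hj]
    simp [w, smul_smul, hσ]
  · have hσ : σ j = 0 := T.singularValues_eq_zero_iff_le_finrank_range.mpr (not_lt.mp hj)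
    rw [hzero j hσ, hσ]
    simp

end LinearMaps

/-! ### The trace inner product and the operator norm -/

section Matrices

open Matrix

variable {m n k : ℕ}

theorem dot_eq_trace (A B : Mat m n) : dot A B = (Aᵀ * B).trace := by
  simp only [dot, Matrix.trace, Matrix.diag_apply, Matrix.mul_apply, Matrix.transpose_apply]
  exact Finset.sum_comm

theorem dot_comm (A B : Mat m n) : dot A B = dot B A := by
  simp only [dot, mul_comm]

theorem dot_add_right (A B C : Mat m n) : dot A (B + C) = dot A B + dot A C := by
  simp only [dot, Matrix.add_apply, mul_add, Finset.sum_add_distrib]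

theorem dot_add_left (A B C : Mat m n) : dot (A + B) C = dot A C + dot B C := by
  simp only [dot, Matrix.add_apply, add_mul, Finset.sum_add_distrib]

theorem dot_smul_right (c : ℝ) (A B : Mat m n) : dot A (c • B) = c * dot A B := by
  simp only [dot, Matrix.smul_apply, smul_eq_mul, Finset.mul_sum]
  exact Finset.sum_congr rfl fun _ _ => Finset.sum_congr rfl fun _ _ => by ring

theorem dot_smul_left (c : ℝ) (A B : Mat m n) : dot (c • A) B = c * dot A B := by
  rw [dot_comm, dot_smul_right, dot_comm]

theorem dot_neg_right (A B : Mat m n) : dot A (-B) = -dot A B := by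
  simp [dot]

theorem dot_neg_left (A B : Mat m n) : dot (-A) B = -dot A B := by
  simp [dot]

theorem dot_sub_right (A B C : Mat m n) : dot A (B - C) = dot A B - dot A C := by
  rw [sub_eq_add_neg, dot_add_right, dot_neg_right, sub_eq_add_neg]

theorem dot_sub_left (A B C : Mat m n) : dot (A - B) C = dot A C - dot B C := by
  rw [dot_comm, dot_sub_right, dot_comm C A, dot_comm C B]

theorem dot_self_nonneg (A : Mat m n) : 0 ≤ dot A A :=
  Finset.sum_nonneg fun _ _ => Finset.sum_nonneg fun _ _ => mul_self_nonneg _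

theorem frobNorm_nonneg (A : Mat m n) : 0 ≤ frobNorm A := Real.sqrt_nonneg _

theorem frobNorm_sq (A : Mat m n) : frobNorm A ^ 2 = dot A A := Real.sq_sqrt (dot_self_nonneg A)

theorem frobNorm_le_iff {A B : Mat m n} : frobNorm A ≤ frobNorm B ↔ dot A A ≤ dot B B :=
  Real.sqrt_le_sqrt_iff (dot_self_nonneg B)

theorem frobNorm_neg (A : Mat m n) : frobNorm (-A) = frobNorm A := by
  simp [frobNorm, dot]

theorem frobNorm_sub_comm (A B : Mat m n) : frobNorm (A - B) = frobNorm (B - A) := by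
  rw [← frobNorm_neg, neg_sub]

theorem dot_mul_left (A : Mat m k) (B : Mat k n) (C : Mat m n) :
    dot (A * B) C = dot B (Aᵀ * C) := by
  simp only [dot_eq_trace, Matrix.transpose_mul, Matrix.mul_assoc]

theorem dot_mul_right (A : Mat m k) (B : Mat k n) (C : Mat m n) :
    dot (A * B) C = dot A (C * Bᵀ) := by
  simp only [dot_eq_trace, Matrix.transpose_mul, ← Matrix.mul_assoc]
  rw [Matrix.mul_assoc, Matrix.trace_mul_comm]

theorem dot_svd (U : Mat m k) (V : Mat n k) (a : Fin k → ℝ) (B : Mat m n) :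
    dot (U * diagonal a * Vᵀ) B = ∑ i, a i * (Uᵀ * B * V) i i := by
  rw [dot_mul_right, dot_mul_left, transpose_transpose, Matrix.mul_assoc]
  simp only [dot, diagonal_apply, ite_mul, zero_mul, Finset.sum_ite_eq, Finset.mem_univ, if_true]

theorem transpose_mul_svd_mul {U : Mat m k} {V : Mat n k} (hU : Uᵀ * U = 1) (hV : Vᵀ * V = 1)
    (a : Fin k → ℝ) : Uᵀ * (U * diagonal a * Vᵀ) * V = diagonal a := by
  rw [show Uᵀ * (U * diagonal a * Vᵀ) * V = (Uᵀ * U) * diagonal a * (Vᵀ * V) by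
    simp only [Matrix.mul_assoc], hU, hV, Matrix.one_mul, Matrix.mul_one]

theorem dot_svd_svd {U : Mat m k} {V : Mat n k} (hU : Uᵀ * U = 1) (hV : Vᵀ * V = 1)
    (a b : Fin k → ℝ) :
    dot (U * diagonal a * Vᵀ) (U * diagonal b * Vᵀ) = ∑ i, a i * b i := by
  simp [dot_svd, transpose_mul_svd_mul hU hV]

theorem norm_toLp_sq (x : Fin n → ℝ) : ‖WithLp.toLp 2 x‖ ^ 2 = x ⬝ᵥ x := by
  rw [EuclideanSpace.real_norm_sq_eq]
  simp [dotProduct, sq]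

theorem inner_toLp (x y : Fin n → ℝ) :
    inner ℝ (WithLp.toLp 2 x) (WithLp.toLp 2 y) = x ⬝ᵥ y := by
  rw [EuclideanSpace.inner_eq_star_dotProduct]
  simp [dotProduct_comm]

theorem opNorm_nonneg (A : Mat m n) : 0 ≤ opNorm A := norm_nonneg _

theorem norm_mulVec_le (A : Mat m n) (x : Fin n → ℝ) :
    ‖WithLp.toLp 2 (A *ᵥ x)‖ ≤ opNorm A * ‖WithLp.toLp 2 x‖ :=
  (LinearMap.toContinuousLinearMap (Matrix.toEuclideanLin A)).le_opNorm (WithLp.toLp 2 x)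

theorem mulVec_dotProduct_le (A : Mat m n) (x : Fin n → ℝ) :
    (A *ᵥ x) ⬝ᵥ (A *ᵥ x) ≤ opNorm A ^ 2 * (x ⬝ᵥ x) := by
  rw [← norm_toLp_sq, ← norm_toLp_sq, ← mul_pow]
  exact pow_le_pow_left₀ (norm_nonneg _) (norm_mulVec_le A x) 2

theorem opNorm_le {A : Mat m n} {c : ℝ} (hc : 0 ≤ c)
    (h : ∀ x : Fin n → ℝ, (A *ᵥ x) ⬝ᵥ (A *ᵥ x) ≤ c ^ 2 * (x ⬝ᵥ x)) : opNorm A ≤ c := by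
  refine ContinuousLinearMap.opNorm_le_bound _ hc fun x => ?_
  refine le_of_sq_le_sq ?_ (by positivity)
  have := h x.ofLp
  rw [← norm_toLp_sq, ← norm_toLp_sq, ← mul_pow] at this
  exact this

theorem mulVec_dotProduct_mulVec (A : Mat m n) (x y : Fin n → ℝ) :
    (A *ᵥ x) ⬝ᵥ (A *ᵥ y) = x ⬝ᵥ ((Aᵀ * A) *ᵥ y) := by
  rw [← Matrix.mulVec_mulVec, Matrix.dotProduct_mulVec x, Matrix.vecMul_transpose]

theorem isometry_mulVec {U : Mat m k} (hU : Uᵀ * U = 1) (x : Fin k → ℝ) :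
    (U *ᵥ x) ⬝ᵥ (U *ᵥ x) = x ⬝ᵥ x := by
  rw [mulVec_dotProduct_mulVec, hU, Matrix.one_mulVec]

/-- Pythagoras for the projection `V Vᵀ`. -/
theorem pythagoras_mulVec {V : Mat n k} (hV : Vᵀ * V = 1) (x : Fin n → ℝ) :
    (Vᵀ *ᵥ x) ⬝ᵥ (Vᵀ *ᵥ x) +
      ((1 - V * Vᵀ) *ᵥ x) ⬝ᵥ ((1 - V * Vᵀ) *ᵥ x) = x ⬝ᵥ x := by
  rw [mulVec_dotProduct_mulVec, mulVec_dotProduct_mulVec, ← dotProduct_add, ← Matrix.add_mulVec]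
  have : (Vᵀ)ᵀ * Vᵀ + (1 - V * Vᵀ)ᵀ * (1 - V * Vᵀ) = 1 := by
    have h : V * Vᵀ * (V * Vᵀ) = V * Vᵀ := by
      rw [Matrix.mul_assoc, ← Matrix.mul_assoc Vᵀ, hV, Matrix.one_mul]
    simp only [transpose_sub, transpose_one, transpose_mul, transpose_transpose, Matrix.mul_sub,
      Matrix.sub_mul, Matrix.one_mul, Matrix.mul_one, h]
    abel
  rw [this, Matrix.one_mulVec]

theorem bessel_mulVec {V : Mat n k} (hV : Vᵀ * V = 1) (x : Fin n → ℝ) :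
    (Vᵀ *ᵥ x) ⬝ᵥ (Vᵀ *ᵥ x) ≤ x ⬝ᵥ x := by
  have := pythagoras_mulVec hV x
  have h0 : 0 ≤ ((1 - V * Vᵀ) *ᵥ x) ⬝ᵥ ((1 - V * Vᵀ) *ᵥ x) := by
    rw [← norm_toLp_sq]; positivity
  linarith

theorem opNorm_svd_le {U : Mat m k} {V : Mat n k} (hU : Uᵀ * U = 1) (hV : Vᵀ * V = 1)
    {a : Fin k → ℝ} {c : ℝ} (hc : 0 ≤ c) (ha : ∀ i, |a i| ≤ c) :
    opNorm (U * diagonal a * Vᵀ) ≤ c := by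
  refine opNorm_le hc fun x => ?_
  rw [← Matrix.mulVec_mulVec, ← Matrix.mulVec_mulVec, isometry_mulVec hU]
  refine le_trans ?_ (mul_le_mul_of_nonneg_left (bessel_mulVec hV x) (sq_nonneg c))
  simp only [dotProduct, mulVec_diagonal, Finset.mul_sum]
  refine Finset.sum_le_sum fun i _ => ?_
  have h : a i ^ 2 ≤ c ^ 2 := sq_le_sq' (by linarith [neg_abs_le (a i), ha i])
    ((le_abs_self _).trans (ha i))
  nlinarith [mul_le_mul_of_nonneg_right h (mul_self_nonneg ((Vᵀ *ᵥ x) i))]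

theorem diag_le_opNorm {U : Mat m k} {V : Mat n k} (hU : Uᵀ * U = 1) (hV : Vᵀ * V = 1)
    (B : Mat m n) (i : Fin k) : (Uᵀ * B * V) i i ≤ opNorm B := by
  have hcol : ∀ {p : ℕ} {W : Mat p k}, Wᵀ * W = 1 → ‖WithLp.toLp 2 (W.col i)‖ = 1 := by
    intro p W hW
    have : ‖WithLp.toLp 2 (W.col i)‖ ^ 2 = 1 := by
      rw [norm_toLp_sq]
      have := congrFun (congrFun hW i) i
      rw [Matrix.one_apply_eq] at this
      exact this
    nlinarith [norm_nonneg (WithLp.toLp 2 (W.col i))]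
  have e : (Uᵀ * B * V) i i = inner ℝ (WithLp.toLp 2 (U.col i)) (WithLp.toLp 2 (B *ᵥ V.col i)) := by
    rw [inner_toLp, Matrix.mul_assoc]
    rfl
  rw [e]
  refine (real_inner_le_norm _ _).trans ?_
  rw [hcol hU, one_mul]
  simpa [hcol hV] using norm_mulVec_le B (V.col i)

/-! ### Singular value decompositions and the nuclear norm -/

/-- The `i`-th singular value of a matrix, `0` for `i ≥ min m n`. -/
noncomputable def sv (A : Mat m n) (i : ℕ) : ℝ := (Matrix.toEuclideanLin A).singularValues i

theorem sv_nonneg (A : Mat m n) (i : ℕ) : 0 ≤ sv A i := LinearMap.singularValues_nonneg _ _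

theorem nuclearNorm_eq_sum_sv (A : Mat m n) :
    nuclearNorm A = ∑ i ∈ Finset.range (min m n), sv A i := rfl

theorem nuclearNorm_nonneg (A : Mat m n) : 0 ≤ nuclearNorm A :=
  Finset.sum_nonneg fun i _ => sv_nonneg A i

theorem finrank_range_toEuclideanLin (A : Mat m n) :
    Module.finrank ℝ (LinearMap.range (Matrix.toEuclideanLin A)) = A.rank := by
  rw [A.rank_eq_finrank_range_toLin (PiLp.basisFun 2 ℝ (Fin m)) (PiLp.basisFun 2 ℝ (Fin n)),
    ← Matrix.toLpLin_eq_toLin]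

theorem sv_eq_zero_of_rank_le {A : Mat m n} {i : ℕ} (h : A.rank ≤ i) : sv A i = 0 :=
  (LinearMap.singularValues_eq_zero_iff_le_finrank_range _).mpr
    ((finrank_range_toEuclideanLin A).trans_le h)

theorem rank_le_min (A : Mat m n) : A.rank ≤ min m n :=
  le_min A.rank_le_height A.rank_le_width

theorem sv_add_le_sv_sub (X : Mat m n) {Y : Mat m n} {s : ℕ} (hY : Y.rank ≤ s) (i : ℕ) :
    sv X (i + s) ≤ sv (X - Y) i := by
  have h := singularValues_add_le (T := Matrix.toEuclideanLin (X - Y))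
    ((finrank_range_toEuclideanLin Y).trans_le hY) i
  rwa [← map_add, sub_add_cancel] at h

theorem sv_svd {U : Mat m k} {V : Mat n k} (hU : Uᵀ * U = 1) (hV : Vᵀ * V = 1) {a : Fin k → ℝ}
    (ha : Antitone a) (h0 : ∀ i, 0 ≤ a i) (i : Fin k) :
    sv (U * diagonal a * Vᵀ) i = a i := by
  refine IsRightSVD.singularValues_eq (v := fun j => WithLp.toLp 2 (V.col j)) ⟨?_, ha, h0, ?_⟩ i
  · rw [orthonormal_iff_ite]
    intro i j
    rw [inner_toLp]
    exact congrFun (congrFun hV i) j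
  · intro x
    change ‖WithLp.toLp 2 ((U * diagonal a * Vᵀ) *ᵥ x.ofLp)‖ ^ 2 = _
    rw [norm_toLp_sq, ← Matrix.mulVec_mulVec, ← Matrix.mulVec_mulVec, isometry_mulVec hU]
    simp only [dotProduct, mulVec_diagonal]
    refine Finset.sum_congr rfl fun j _ => ?_
    have e : inner ℝ (WithLp.toLp 2 (V.col j)) x = (Vᵀ *ᵥ x.ofLp) j :=
      inner_toLp (V.col j) x.ofLp
    rw [e]
    ring

theorem IsFullSVD.sv_eq {Z : Mat m n} {D : SVDData m n (min m n)} (h : IsFullSVD Z D)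
    (i : Fin (min m n)) : sv Z i = D.σ i := by
  rw [h.eq]
  exact sv_svd h.orthoU h.orthoV h.anti h.nonneg i

theorem exists_isFullSVD (Z : Mat m n) : ∃ D, IsFullSVD Z D := by
  obtain ⟨u, v, huv⟩ := exists_orthonormalBasis_svd (Matrix.toEuclideanLin Z)
    (finrank_euclideanSpace_fin (n := m)) (finrank_euclideanSpace_fin (n := n))
  have hm : min m n ≤ m := min_le_left _ _
  have hn : min m n ≤ n := min_le_right _ _
  let U : Mat m (min m n) := .of fun i j => (u (Fin.castLE hm j)).ofLp i
  let V : Mat n (min m n) := .of fun i j => (v (Fin.castLE hn j)).ofLp i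
  have hU : Uᵀ * U = 1 := by
    ext i j
    have := orthonormal_iff_ite.mp u.orthonormal (Fin.castLE hm i) (Fin.castLE hm j)
    simp only [Fin.castLE_inj] at this
    rw [Matrix.one_apply, ← this, ← WithLp.toLp_ofLp 2 (u _), ← WithLp.toLp_ofLp 2 (u _),
      inner_toLp]
    rfl
  have hv : ∀ i j, (v i).ofLp ⬝ᵥ (v j).ofLp = if i = j then (1 : ℝ) else 0 := fun i j => by
    rw [← inner_toLp]
    exact orthonormal_iff_ite.mp v.orthonormal i j
  have hV : Vᵀ * V = 1 := by
    ext i j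
    have := hv (Fin.castLE hn i) (Fin.castLE hn j)
    simp only [Fin.castLE_inj] at this
    rw [Matrix.one_apply, ← this]
    rfl
  refine ⟨⟨U, fun i => sv Z i, V⟩, hU, hV, fun i => sv_nonneg Z i,
    fun i j hij => LinearMap.singularValues_antitone _ hij, ?_⟩
  refine Matrix.toEuclideanLin.injective (v.toBasis.ext fun l => ?_)
  rw [OrthonormalBasis.coe_toBasis, huv l]
  change _ = WithLp.toLp 2 ((U * Matrix.diagonal (fun i : Fin (min m n) => sv Z i) * Vᵀ) *ᵥ (v l).ofLp)
  rw [← Matrix.mulVec_mulVec, ← Matrix.mulVec_mulVec]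
  have hVl : ∀ j, (Vᵀ *ᵥ (v l).ofLp) j = if Fin.castLE hn j = l then 1 else 0 := fun j =>
    hv (Fin.castLE hn j) l
  have key : ∀ i, (U *ᵥ (Matrix.diagonal (fun i : Fin (min m n) => sv Z i) *ᵥ (Vᵀ *ᵥ (v l).ofLp))) i =
      ∑ j, U i j * (sv Z j * if Fin.castLE hn j = l then 1 else 0) := fun i => by
    simp only [Matrix.mulVec, dotProduct] at hVl ⊢
    simp only [hVl, diagonal_apply, ite_mul, zero_mul, Finset.sum_ite_eq, Finset.mem_univ, if_true]
  ext i
  refine Eq.trans ?_ (key i).symm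
  by_cases hl : (l : ℕ) < m
  · have hl' : (l : ℕ) < min m n := lt_min hl l.isLt
    rw [dif_pos hl, Finset.sum_eq_single ⟨l, hl'⟩]
    · have : Fin.castLE hn ⟨l, hl'⟩ = l := rfl
      simp only [this, if_true, mul_one, PiLp.smul_apply, smul_eq_mul]
      rw [mul_comm]
      rfl
    · intro j _ hj
      rw [if_neg (fun h => hj (Fin.ext (by simpa using congrArg Fin.val h)))]
      simp
    · simp
  · rw [dif_neg hl, Finset.sum_eq_zero]
    · rfl
    · intro j _
      rw [if_neg]
      · simp
      · rintro rfl
        exact hl (lt_of_lt_of_le j.isLt hm)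

theorem IsFullSVD.nuclearNorm_eq {Z : Mat m n} {D : SVDData m n (min m n)} (h : IsFullSVD Z D) :
    nuclearNorm Z = ∑ i, D.σ i := by
  rw [nuclearNorm_eq_sum_sv, ← Fin.sum_univ_eq_sum_range]
  exact Finset.sum_congr rfl fun i _ => h.sv_eq i

theorem dot_self_eq_sum_sv (Z : Mat m n) : dot Z Z = ∑ i ∈ Finset.range (min m n), sv Z i ^ 2 := by
  obtain ⟨D, h⟩ := exists_isFullSVD Z
  rw [← Fin.sum_univ_eq_sum_range (fun i => sv Z i ^ 2)]
  conv_lhs => rw [h.eq]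
  rw [dot_svd_svd h.orthoU h.orthoV]
  exact Finset.sum_congr rfl fun i _ => by rw [h.sv_eq i, sq]

/-- The operator norm and the nuclear norm are dual to each other: Hölder's inequality. -/
theorem dot_le_opNorm_mul_nuclearNorm (A B : Mat m n) : dot A B ≤ opNorm A * nuclearNorm B := by
  obtain ⟨D, h⟩ := exists_isFullSVD B
  rw [h.nuclearNorm_eq, dot_comm, h.eq, dot_svd, Finset.mul_sum]
  refine Finset.sum_le_sum fun i _ => ?_
  rw [mul_comm (opNorm A)]
  exact mul_le_mul_of_nonneg_left (diag_le_opNorm h.orthoU h.orthoV A i) (h.nonneg i)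

/-- The nuclear norm is attained as a pairing with a contraction. -/
theorem exists_dot_eq_nuclearNorm (B : Mat m n) : ∃ W, opNorm W ≤ 1 ∧ dot W B = nuclearNorm B := by
  obtain ⟨D, h⟩ := exists_isFullSVD B
  refine ⟨D.U * Matrix.diagonal (fun _ => 1) * D.Vᵀ,
    opNorm_svd_le h.orthoU h.orthoV zero_le_one (by simp), ?_⟩
  rw [h.nuclearNorm_eq]
  conv_lhs => rw [h.eq]
  rw [dot_svd_svd h.orthoU h.orthoV]
  simp

theorem dot_le_nuclearNorm {W : Mat m n} (hW : opNorm W ≤ 1) (B : Mat m n) :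
    dot W B ≤ nuclearNorm B :=
  (dot_le_opNorm_mul_nuclearNorm W B).trans
    (mul_le_of_le_one_left (nuclearNorm_nonneg B) hW)

theorem nuclearNorm_add_le (A B : Mat m n) :
    nuclearNorm (A + B) ≤ nuclearNorm A + nuclearNorm B := by
  obtain ⟨W, hW, h⟩ := exists_dot_eq_nuclearNorm (A + B)
  rw [← h, dot_add_right]
  exact add_le_add (dot_le_nuclearNorm hW A) (dot_le_nuclearNorm hW B)

theorem opNorm_neg (A : Mat m n) : opNorm (-A) = opNorm A := by
  simp [opNorm]

theorem nuclearNorm_smul_le {c : ℝ} (hc : 0 ≤ c) (A : Mat m n) :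
    nuclearNorm (c • A) ≤ c * nuclearNorm A := by
  obtain ⟨W, hW, h⟩ := exists_dot_eq_nuclearNorm (c • A)
  rw [← h, dot_smul_right]
  exact mul_le_mul_of_nonneg_left (dot_le_nuclearNorm hW A) hc

theorem nuclearNorm_neg_le (A : Mat m n) : nuclearNorm (-A) ≤ nuclearNorm A := by
  obtain ⟨W, hW, h⟩ := exists_dot_eq_nuclearNorm (-A)
  rw [← h, dot_neg_right, ← dot_neg_left]
  exact dot_le_nuclearNorm (by rwa [opNorm_neg]) A

theorem nuclearNorm_neg (A : Mat m n) : nuclearNorm (-A) = nuclearNorm A :=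
  le_antisymm (nuclearNorm_neg_le A) (by simpa using nuclearNorm_neg_le (-A))

theorem nuclearNorm_sub_comm (A B : Mat m n) : nuclearNorm (A - B) = nuclearNorm (B - A) := by
  rw [← nuclearNorm_neg, neg_sub]

/-- In contrast to `sv_svd`, the values `a i` need not be sorted. -/
theorem nuclearNorm_svd {U : Mat m k} {V : Mat n k} (hU : Uᵀ * U = 1) (hV : Vᵀ * V = 1)
    {a : Fin k → ℝ} (h0 : ∀ i, 0 ≤ a i) : nuclearNorm (U * diagonal a * Vᵀ) = ∑ i, a i := by
  apply le_antisymm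
  · obtain ⟨W, hW, h⟩ := exists_dot_eq_nuclearNorm (U * diagonal a * Vᵀ)
    rw [← h, dot_comm, dot_svd]
    exact Finset.sum_le_sum fun i _ => mul_le_of_le_one_right (h0 i)
      ((diag_le_opNorm hU hV W i).trans hW)
  · have h := dot_le_nuclearNorm (opNorm_svd_le hU hV (a := fun _ => 1) zero_le_one (by simp))
      (U * diagonal a * Vᵀ)
    rw [dot_svd_svd hU hV] at h
    simpa using h

theorem nuclearNorm_le_sqrt_mul_frobNorm {A : Mat m n} {r : ℕ} (h : A.rank ≤ r) :
    nuclearNorm A ≤ Real.sqrt r * frobNorm A := by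
  rw [nuclearNorm_eq_sum_sv, frobNorm, dot_self_eq_sum_sv, ← Real.sqrt_mul (Nat.cast_nonneg r)]
  apply Real.le_sqrt_of_sq_le
  set t := (Finset.range (min m n)).filter (· < r)
  have h1 : ∑ i ∈ Finset.range (min m n), sv A i = ∑ i ∈ t, sv A i :=
    (Finset.sum_filter_of_ne fun i _ hi => by
      by_contra hir
      exact hi (sv_eq_zero_of_rank_le (h.trans (not_lt.mp hir)))).symm
  have h2 : (t.card : ℝ) ≤ r := by
    have : t ⊆ Finset.range r := fun i hi => Finset.mem_range.mpr (Finset.mem_filter.mp hi).2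
    exact_mod_cast (Finset.card_le_card this).trans_eq (Finset.card_range r)
  rw [h1]
  calc (∑ i ∈ t, sv A i) ^ 2 ≤ t.card * ∑ i ∈ t, sv A i ^ 2 := sq_sum_le_card_mul_sum_sq
    _ ≤ r * ∑ i ∈ Finset.range (min m n), sv A i ^ 2 := by
      refine mul_le_mul h2 ?_ (Finset.sum_nonneg fun _ _ => sq_nonneg _) (Nat.cast_nonneg r)
      exact Finset.sum_le_sum_of_subset_of_nonneg (Finset.filter_subset _ _)
        fun _ _ _ => sq_nonneg _

end Matrices

/-! ### Truncated decompositions and best approximation of low rank -/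

section Truncation

open Matrix

variable {m n k s : ℕ}

theorem sum_castLE (hs : s ≤ k) (f : Fin k → ℝ) :
    ∑ j : Fin s, f (Fin.castLE hs j) = ∑ j : Fin k, if (j : ℕ) < s then f j else 0 := by
  rw [← Finset.sum_filter]
  refine (Finset.sum_map Finset.univ (Fin.castLEEmb hs) f).symm.trans ?_
  congr 1
  ext j
  simp only [Finset.mem_map, Finset.mem_univ, true_and, Finset.mem_filter]
  exact ⟨by rintro ⟨i, rfl⟩; exact i.isLt, fun hj => ⟨⟨j, hj⟩, rfl⟩⟩

/-- Shifting the index discards the first `s` terms, as `f` vanishes from `K` on. -/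
theorem sum_range_shift {K : ℕ} {f : ℕ → ℝ} (hf : ∀ i, K ≤ i → f i = 0) (s : ℕ) :
    ∑ i ∈ Finset.range K, f (i + s) = ∑ i ∈ Finset.range K, if i < s then 0 else f i := by
  have h1 := Finset.sum_range_add (fun i => if i < s then 0 else f i) s K
  have h2 := Finset.sum_range_add (fun i => if i < s then 0 else f i) K s
  rw [add_comm K s, h1] at h2
  have h3 : ∑ i ∈ Finset.range s, (if i < s then 0 else f i) = 0 :=
    Finset.sum_eq_zero fun i hi => if_pos (Finset.mem_range.mp hi)
  have h4 : ∑ i ∈ Finset.range s, (if K + i < s then 0 else f (K + i)) = 0 :=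
    Finset.sum_eq_zero fun i _ => by simp [hf (K + i) (by omega)]
  rw [h3, h4, zero_add, add_zero] at h2
  rw [← h2]
  exact Finset.sum_congr rfl fun i _ => by rw [if_neg (by omega), add_comm]

/-- The first `s` columns of a matrix with `k` columns. -/
def headCols (hs : s ≤ k) (U : Mat m k) : Mat m s := U.submatrix id (Fin.castLE hs)

theorem headCols_ortho (hs : s ≤ k) {U : Mat m k} (hU : Uᵀ * U = 1) :
    (headCols hs U)ᵀ * headCols hs U = 1 := by
  have : (headCols hs U)ᵀ * headCols hs U = (Uᵀ * U).submatrix (Fin.castLE hs) (Fin.castLE hs) :=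
    rfl
  rw [this, hU, submatrix_one _ (Fin.castLE_injective hs)]

/-- Truncating all three factors amounts to setting the values from index `s` on to zero. -/
theorem headCols_svd (hs : s ≤ k) (U : Mat m k) (V : Mat n k) (a : Fin k → ℝ) :
    headCols hs U * Matrix.diagonal (fun j => a (Fin.castLE hs j)) * (headCols hs V)ᵀ =
      U * Matrix.diagonal (fun j : Fin k => if (j : ℕ) < s then a j else 0) * Vᵀ := by
  ext i l
  have h := sum_castLE hs (fun j => U i j * a j * V l j)
  rw [mul_apply, mul_apply]
  simp only [mul_diagonal, transpose_apply]
  refine Eq.trans h (Finset.sum_congr rfl fun j _ => ?_)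
  split_ifs <;> simp

theorem rank_svd_le (U : Mat m s) (a : Fin s → ℝ) (V : Mat n s) :
    (U * Matrix.diagonal a * Vᵀ).rank ≤ s :=
  ((rank_mul_le_left _ _).trans (rank_mul_le_left _ _)).trans U.rank_le_width

/-- Eckart–Young lower bound in the Euclidean norm. -/
theorem sum_sv_sq_le_dot_sub (X : Mat m n) {Y : Mat m n} (hY : Y.rank ≤ s) :
    ∑ i ∈ Finset.range (min m n), sv X (i + s) ^ 2 ≤ dot (X - Y) (X - Y) := by
  rw [dot_self_eq_sum_sv]
  exact Finset.sum_le_sum fun i _ => pow_le_pow_left₀ (sv_nonneg _ _) (sv_add_le_sv_sub X hY i) 2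

/-- Eckart–Young lower bound in the nuclear norm. -/
theorem sum_sv_le_nuclearNorm_sub (X : Mat m n) {Y : Mat m n} (hY : Y.rank ≤ s) :
    ∑ i ∈ Finset.range (min m n), sv X (i + s) ≤ nuclearNorm (X - Y) :=
  Finset.sum_le_sum fun i _ => sv_add_le_sv_sub X hY i

theorem IsFullSVD.sub_headCols {X : Mat m n} {D : SVDData m n (min m n)} (h : IsFullSVD X D)
    (hs : s ≤ min m n) :
    X - headCols hs D.U * Matrix.diagonal (fun j => D.σ (Fin.castLE hs j)) * (headCols hs D.V)ᵀ =
      D.U * Matrix.diagonal (fun j : Fin (min m n) => if (j : ℕ) < s then 0 else D.σ j) * D.Vᵀ := by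
  conv_lhs => rw [h.eq]
  rw [headCols_svd, ← Matrix.sub_mul, ← Matrix.mul_sub, diagonal_sub]
  congr 3
  ext j
  split_ifs <;> simp

theorem sv_eq_zero_of_min_le {X : Mat m n} {i : ℕ} (h : min m n ≤ i) : sv X i = 0 :=
  sv_eq_zero_of_rank_le ((rank_le_min X).trans h)

theorem IsFullSVD.dot_sub_headCols {X : Mat m n} {D : SVDData m n (min m n)} (h : IsFullSVD X D)
    (hs : s ≤ min m n) {Y : Mat m n}
    (hY : Y = headCols hs D.U * Matrix.diagonal (fun j => D.σ (Fin.castLE hs j)) *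
      (headCols hs D.V)ᵀ) :
    dot (X - Y) (X - Y) = ∑ i ∈ Finset.range (min m n), sv X (i + s) ^ 2 := by
  rw [sum_range_shift (f := fun i => sv X i ^ 2) (fun i hi => by simp [sv_eq_zero_of_min_le hi]),
    hY, h.sub_headCols hs, dot_svd_svd h.orthoU h.orthoV,
    ← Fin.sum_univ_eq_sum_range (fun i => if i < s then 0 else sv X i ^ 2)]
  refine Finset.sum_congr rfl fun i _ => ?_
  rw [h.sv_eq]
  split_ifs <;> ring

theorem IsFullSVD.nuclearNorm_sub_headCols {X : Mat m n} {D : SVDData m n (min m n)}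
    (h : IsFullSVD X D) (hs : s ≤ min m n) {Y : Mat m n}
    (hY : Y = headCols hs D.U * Matrix.diagonal (fun j => D.σ (Fin.castLE hs j)) *
      (headCols hs D.V)ᵀ) :
    nuclearNorm (X - Y) = ∑ i ∈ Finset.range (min m n), sv X (i + s) := by
  rw [sum_range_shift (f := sv X) (fun i hi => sv_eq_zero_of_min_le hi),
    hY, h.sub_headCols hs, nuclearNorm_svd h.orthoU h.orthoV,
    ← Fin.sum_univ_eq_sum_range (fun i => if i < s then 0 else sv X i)]
  · exact Finset.sum_congr rfl fun i _ => by rw [h.sv_eq]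
  · intro i
    split_ifs
    exacts [le_rfl, h.nonneg i]

/-- The rank-`s` truncation of an SVD is a best approximation in the Euclidean norm. -/
theorem IsFullSVD.headCols_mem_argminOn {X : Mat m n} {D : SVDData m n (min m n)}
    (h : IsFullSVD X D) (hs : s ≤ min m n) {Y : Mat m n}
    (hY : Y = headCols hs D.U * Matrix.diagonal (fun j => D.σ (Fin.castLE hs j)) *
      (headCols hs D.V)ᵀ) :
    Y ∈ argminOn (fun y => frobNorm (y - X)) (lowRank m n s) := by
  refine ⟨hY ▸ rank_svd_le _ _ _, fun Z hZ => ?_⟩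
  simp only [frobNorm_sub_comm _ X]
  rw [frobNorm_le_iff, h.dot_sub_headCols hs hY]
  exact sum_sv_sq_le_dot_sub X hZ

/-- A matrix of rank at most `s` is a best approximation of `X` in the Euclidean norm exactly if
it attains equality in all of Weyl's inequalities. -/
theorem mem_argminOn_frobNorm_iff (hs : s ≤ min m n) {X Y : Mat m n} :
    Y ∈ argminOn (fun y => frobNorm (y - X)) (lowRank m n s) ↔
      Y.rank ≤ s ∧ ∀ i ∈ Finset.range (min m n), sv X (i + s) = sv (X - Y) i := by
  obtain ⟨D, h⟩ := exists_isFullSVD X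
  refine and_congr_right fun hY => ?_
  have hle : ∀ i ∈ Finset.range (min m n), sv X (i + s) ^ 2 ≤ sv (X - Y) i ^ 2 := fun i _ =>
    pow_le_pow_left₀ (sv_nonneg _ _) (sv_add_le_sv_sub X hY i) 2
  have hsq : (∀ i ∈ Finset.range (min m n), sv X (i + s) ^ 2 = sv (X - Y) i ^ 2) ↔
      ∀ i ∈ Finset.range (min m n), sv X (i + s) = sv (X - Y) i :=
    forall₂_congr fun i _ => sq_eq_sq₀ (sv_nonneg _ _) (sv_nonneg _ _)
  rw [← hsq, ← Finset.sum_eq_sum_iff_of_le hle, ← dot_self_eq_sum_sv]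
  simp only [frobNorm_sub_comm _ X, frobNorm_le_iff]
  constructor
  · intro hmin
    refine le_antisymm (sum_sv_sq_le_dot_sub X hY) ?_
    rw [← h.dot_sub_headCols hs rfl]
    exact hmin _ (rank_svd_le _ _ _)
  · intro heq Z hZ
    rw [← heq]
    exact sum_sv_sq_le_dot_sub X hZ

/-- The same equalities characterize best approximation in the nuclear norm. -/
theorem mem_argminOn_nuclearNorm_iff (hs : s ≤ min m n) {X Y : Mat m n} :
    Y ∈ argminOn (fun y => nuclearNorm (y - X)) (lowRank m n s) ↔
      Y.rank ≤ s ∧ ∀ i ∈ Finset.range (min m n), sv X (i + s) = sv (X - Y) i := by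
  obtain ⟨D, h⟩ := exists_isFullSVD X
  refine and_congr_right fun hY => ?_
  rw [← Finset.sum_eq_sum_iff_of_le fun i _ => sv_add_le_sv_sub X hY i, ← nuclearNorm_eq_sum_sv]
  simp only [nuclearNorm_sub_comm _ X]
  constructor
  · intro hmin
    refine le_antisymm (sum_sv_le_nuclearNorm_sub X hY) ?_
    rw [← h.nuclearNorm_sub_headCols hs rfl]
    exact hmin _ (rank_svd_le _ _ _)
  · intro heq Z hZ
    rw [← heq]
    exact sum_sv_le_nuclearNorm_sub X hZ

/-! ### The structural assumption for the nuclear norm -/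

theorem rank_add_le (A B : Mat m n) : (A + B).rank ≤ A.rank + B.rank := by
  unfold Matrix.rank
  rw [mulVecLin_add]
  exact (Submodule.finrank_mono (LinearMap.range_add_le _ _)).trans
    (Submodule.finrank_add_le_finrank_add_finrank _ _)

theorem rank_sub_le (A B : Mat m n) : (A - B).rank ≤ A.rank + B.rank := by
  have hB : (-B).rank ≤ B.rank := by
    rw [← Matrix.mul_one (-B), Matrix.neg_mul, ← Matrix.mul_neg]
    exact rank_mul_le_left _ _
  rw [sub_eq_add_neg]
  exact (rank_add_le _ _).trans (Nat.add_le_add_left hB _)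

theorem isClosed_lowRank (m n s : ℕ) : IsClosed (lowRank m n s) := by
  have hc : Continuous fun A : Mat m n =>
      LinearMap.toContinuousLinearMap (Matrix.toEuclideanLin A) :=
    (LinearMap.toContinuousLinearMap.toLinearMap ∘ₗ
      (Matrix.toEuclideanLin (𝕜 := ℝ) (m := Fin m) (n := Fin n)).toLinearMap).continuous_of_finiteDimensional
  rw [← isOpen_compl_iff]
  convert (isOpen_setOfPred_nat_le_rank (𝕜 := ℝ) (E := EuclideanSpace ℝ (Fin n))
    (F := EuclideanSpace ℝ (Fin m)) (s + 1)).preimage hc using 1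
  ext A
  have : LinearMap.rank (Matrix.toEuclideanLin A) = (A.rank : Cardinal) := by
    rw [← finrank_range_toEuclideanLin A, Module.finrank_eq_rank]
  change ¬ A.rank ≤ s ↔ ((s + 1 : ℕ) : Cardinal) ≤ LinearMap.rank (Matrix.toEuclideanLin A)
  rw [this, Nat.cast_le]
  omega

theorem one_sub_proj_transpose (A : Mat m s) : (1 - A * Aᵀ)ᵀ = 1 - A * Aᵀ := by
  simp [transpose_sub]

theorem one_sub_proj_mul {A : Mat m s} (hA : Aᵀ * A = 1) : (1 - A * Aᵀ) * A = 0 := by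
  rw [Matrix.sub_mul, Matrix.mul_assoc, hA]
  simp

theorem one_sub_proj_mul_self {A : Mat m s} (hA : Aᵀ * A = 1) :
    (1 - A * Aᵀ) * (1 - A * Aᵀ) = 1 - A * Aᵀ := by
  rw [Matrix.mul_sub, ← Matrix.mul_assoc, one_sub_proj_mul hA]
  simp

/-- A contraction that aligns the column and row spaces of `A` and `B` may be extended by any
contraction between the orthogonal complements. -/
theorem opNorm_add_compl_le {A : Mat m s} {B : Mat n s} (hA : Aᵀ * A = 1) (hB : Bᵀ * B = 1)
    {W : Mat m n} (hW : opNorm W ≤ 1) :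
    opNorm (A * Bᵀ + (1 - A * Aᵀ) * W * (1 - B * Bᵀ)) ≤ 1 := by
  refine opNorm_le zero_le_one fun x => ?_
  set q := (1 - B * Bᵀ) *ᵥ x with hq
  set y := W *ᵥ q with hy
  set z := Bᵀ *ᵥ x with hz
  have e : (A * Bᵀ + (1 - A * Aᵀ) * W * (1 - B * Bᵀ)) *ᵥ x = A *ᵥ z + (1 - A * Aᵀ) *ᵥ y := by
    simp only [hq, hy, hz, Matrix.add_mulVec, Matrix.mulVec_mulVec, Matrix.mul_assoc]
  have hcross : (A *ᵥ z) ⬝ᵥ ((1 - A * Aᵀ) *ᵥ y) = 0 := by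
    rw [Matrix.dotProduct_mulVec, ← Matrix.mulVec_transpose, one_sub_proj_transpose,
      Matrix.mulVec_mulVec, one_sub_proj_mul hA]
    simp
  have hcross' : ((1 - A * Aᵀ) *ᵥ y) ⬝ᵥ (A *ᵥ z) = 0 := (dotProduct_comm _ _).trans hcross
  have h1 : ((1 - A * Aᵀ) *ᵥ y) ⬝ᵥ ((1 - A * Aᵀ) *ᵥ y) ≤ y ⬝ᵥ y := by
    have := pythagoras_mulVec hA y
    have h0 : 0 ≤ (Aᵀ *ᵥ y) ⬝ᵥ (Aᵀ *ᵥ y) := by rw [← norm_toLp_sq]; positivity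
    linarith
  have h2 : y ⬝ᵥ y ≤ q ⬝ᵥ q := by
    have hqq : 0 ≤ q ⬝ᵥ q := by rw [← norm_toLp_sq]; positivity
    refine (mulVec_dotProduct_le W q).trans (mul_le_of_le_one_left hqq ?_)
    exact pow_le_one₀ (opNorm_nonneg W) hW
  have h3 := pythagoras_mulVec hB x
  rw [e, add_dotProduct, dotProduct_add, dotProduct_add, hcross, hcross', isometry_mulVec hA]
  linarith

/-- If the nuclear norm at `X` is at most that at `Y = A diag(a) Bᵀ`, the part of `X - Y` outside
the tangent space at `Y` is dominated by the part inside, which has rank at most `2 s`. -/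
theorem nuclearNorm_sub_le_of_le {A : Mat m s} {B : Mat n s} (hA : Aᵀ * A = 1) (hB : Bᵀ * B = 1)
    {a : Fin s → ℝ} {X Y : Mat m n} (hY : Y = A * Matrix.diagonal a * Bᵀ)
    (hX : nuclearNorm X ≤ ∑ i, a i) :
    nuclearNorm (X - Y) ≤ Real.sqrt (8 * s) * frobNorm (X - Y) := by
  set P := 1 - A * Aᵀ with hP
  set Q := 1 - B * Bᵀ with hQ
  have hPt : Pᵀ = P := one_sub_proj_transpose A
  have hQt : Qᵀ = Q := one_sub_proj_transpose B
  have hPA : P * A = 0 := one_sub_proj_mul hA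
  have hPP : P * P = P := one_sub_proj_mul_self hA
  have hQQ : Q * Q = Q := one_sub_proj_mul_self hB
  have hmove : ∀ M L : Mat m n, dot (P * M * Q) L = dot M (P * L * Q) := fun M L => by
    rw [dot_mul_right, dot_mul_left, hPt, hQt, Matrix.mul_assoc]
  clear_value P Q
  set Δ := X - Y with hΔ
  clear_value Δ
  set N := P * Δ * Q with hN
  clear_value N
  set T := Δ - N with hT
  clear_value T
  have hPNQ : P * N * Q = N := by
    rw [hN, show P * (P * Δ * Q) * Q = (P * P) * Δ * (Q * Q) by simp only [Matrix.mul_assoc],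
      hPP, hQQ]
  have hrankT : T.rank ≤ 2 * s := by
    have e : T = A * (Aᵀ * Δ) + P * Δ * B * Bᵀ := by
      have hAA : A * Aᵀ = 1 - P := by rw [hP, sub_sub_cancel]
      have hBB : B * Bᵀ = 1 - Q := by rw [hQ, sub_sub_cancel]
      rw [show A * (Aᵀ * Δ) + P * Δ * B * Bᵀ = A * Aᵀ * Δ + P * Δ * (B * Bᵀ) by
          simp only [Matrix.mul_assoc], hAA, hBB, hT, hN, Matrix.sub_mul, Matrix.one_mul,
          Matrix.mul_sub, Matrix.mul_one]
      abel
    have h1 : (A * (Aᵀ * Δ)).rank ≤ s := (rank_mul_le_left _ _).trans A.rank_le_width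
    have h2 : (P * Δ * B * Bᵀ).rank ≤ s := (rank_mul_le_left _ _).trans (rank_le_width _)
    have h3 := rank_add_le (A * (Aᵀ * Δ)) (P * Δ * B * Bᵀ)
    rw [e]
    omega
  have hpyth : dot Δ Δ = dot T T + dot N N := by
    have h1 : dot N N = dot Δ N := by
      conv_lhs => rw [hN, hmove, ← hN, hPNQ]
    rw [hT, dot_sub_left, dot_sub_right, dot_sub_right, dot_comm N Δ, h1]
    ring
  have hfrob : frobNorm T ≤ frobNorm Δ := by
    rw [frobNorm_le_iff, hpyth]
    linarith [dot_self_nonneg N]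
  -- `W` is a subgradient of the nuclear norm at `Y` that is aligned with `N`
  obtain ⟨W', hW', hWN⟩ := exists_dot_eq_nuclearNorm N
  set W := A * Bᵀ + P * W' * Q with hW
  have hW1 : opNorm W ≤ 1 := by
    rw [hW, hP, hQ]
    exact opNorm_add_compl_le hA hB hW'
  have hWY : dot W Y = ∑ i, a i := by
    have h0 : P * Y * Q = 0 := by
      rw [hY, show P * (A * Matrix.diagonal a * Bᵀ) * Q = (P * A) * (Matrix.diagonal a * Bᵀ * Q) by
        simp only [Matrix.mul_assoc], hPA, Matrix.zero_mul]
    have h1 : dot (A * Bᵀ) Y = ∑ i, a i := by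
      have := dot_svd_svd hA hB (fun _ => 1) a
      rw [diagonal_one, Matrix.mul_one, ← hY] at this
      simpa using this
    rw [hW, dot_add_left, hmove, h0, h1]
    simp [dot]
  have hWN' : dot W N = nuclearNorm N := by
    have h0 : dot (A * Bᵀ) N = 0 := by
      rw [← hPNQ, ← hmove, ← Matrix.mul_assoc, hPA]
      simp [dot]
    rw [hW, dot_add_left, h0, hmove, hPNQ, hWN, zero_add]
  have hsplit : X = Y + (T + N) := by
    rw [hT, sub_add_cancel, hΔ, add_sub_cancel]
  have h1 : dot W X ≤ nuclearNorm X := dot_le_nuclearNorm hW1 X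
  rw [hsplit, dot_add_right, dot_add_right, hWY, hWN', ← hsplit] at h1
  have h2 : dot W (-T) ≤ nuclearNorm T := by
    rw [← nuclearNorm_neg T]
    exact dot_le_nuclearNorm hW1 _
  rw [dot_neg_right] at h2
  have h3 : nuclearNorm Δ ≤ nuclearNorm T + nuclearNorm N := by
    have := nuclearNorm_add_le T N
    rwa [hT, sub_add_cancel, ← hT] at this
  have h4 := nuclearNorm_le_sqrt_mul_frobNorm hrankT
  have h5 : Real.sqrt (8 * s) = 2 * Real.sqrt ((2 * s : ℕ) : ℝ) := by
    rw [show (8 : ℝ) * s = 2 ^ 2 * ((2 * s : ℕ) : ℝ) by push_cast; ring,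
      Real.sqrt_mul (by norm_num), Real.sqrt_sq (by norm_num)]
  rw [h5]
  have h6 := mul_le_mul_of_nonneg_left hfrob (Real.sqrt_nonneg ((2 * s : ℕ) : ℝ))
  linarith

theorem nuclearNorm_sub_le_of_rank_le (hs : s ≤ min m n) {X Y : Mat m n} (hY : Y.rank ≤ s)
    (hX : nuclearNorm X ≤ nuclearNorm Y) :
    nuclearNorm (X - Y) ≤ Real.sqrt (8 * s) * frobNorm (X - Y) := by
  obtain ⟨D, h⟩ := exists_isFullSVD Y
  have hzero : ∀ j : Fin (min m n), ¬ (j : ℕ) < s → D.σ j = 0 := fun j hj => by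
    rw [← h.sv_eq j]
    exact sv_eq_zero_of_rank_le (hY.trans (not_lt.mp hj))
  have hmask : (fun j : Fin (min m n) => if (j : ℕ) < s then D.σ j else 0) = D.σ := by
    funext j
    split_ifs with hj
    exacts [rfl, (hzero j hj).symm]
  refine nuclearNorm_sub_le_of_le (headCols_ortho hs h.orthoU) (headCols_ortho hs h.orthoV)
    (a := fun j => D.σ (Fin.castLE hs j)) ?_ ?_
  · rw [headCols_svd, hmask]
    exact h.eq
  · rw [sum_castLE hs, hmask, ← h.nuclearNorm_eq]
    exact hX

theorem NuclearProblem.sparsityAssumption {f : Mat m n → ℝ} {g : Mat m n → Mat m n}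
    {R β α₂ : ℝ} (hP : NuclearProblem s f g R β α₂) :
    SparsityAssumption nuclearNorm frobNorm (nuclearBall m n R) (argminOn f (nuclearBall m n R))
      (lowRank m n s) (s : ℝ) (8 * s) := by
  have h1 : (1 : ℝ) ≤ s := by exact_mod_cast hP.one_le_s
  refine ⟨isClosed_lowRank m n s, fun X hX => ⟨hX.1, hP.rank_opt X hX⟩, h1, by linarith,
    fun X hX Y hY => ?_, fun X hX Xs hXs => ?_, fun X _ => ?_⟩
  · have h := nuclearNorm_le_sqrt_mul_frobNorm
      (((rank_sub_le X Y).trans (Nat.add_le_add hX hY)).trans_eq (two_mul s).symm)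
    push_cast at h
    exact h
  · exact nuclearNorm_sub_le_of_rank_le hP.s_le (hP.rank_opt Xs hXs)
      ((show nuclearNorm X ≤ R from hX).trans_eq (hP.tight_opt Xs hXs).symm)
  · ext Y
    rw [mem_argminOn_frobNorm_iff hP.s_le, mem_argminOn_nuclearNorm_iff hP.s_le]

end Truncation

/-! ### Linear convergence -/

section Convergence

variable {m n s : ℕ} {f : Mat m n → ℝ} {g : Mat m n → Mat m n} {R β α₂ : ℝ}

theorem IsGradientAt.hasDerivAt_line {G X D : Mat m n} {t : ℝ} (h : IsGradientAt f G (X + t • D)) :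
    HasDerivAt (fun t : ℝ => f (X + t • D)) (dot G D) t := by
  obtain ⟨L, hL, hf⟩ := h
  let _ : NormedAddCommGroup (Mat m n) := Matrix.normedAddCommGroup
  let _ : NormedSpace ℝ (Mat m n) := Matrix.normedSpace
  have hline : HasDerivAt (fun t : ℝ => X + t • D) D t :=
    (((hasDerivAt_id t).smul_const D).const_add X).congr_deriv (one_smul ℝ D)
  rw [← hL]
  exact HasFDerivAt.comp_hasDerivAt t hf hline

theorem add_smul_sub_mem {K : Set (Mat m n)} (hK : Convex ℝ K) {X V : Mat m n} (hX : X ∈ K)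
    (hV : V ∈ K) {t : ℝ} (ht : t ∈ Icc (0 : ℝ) 1) : X + t • (V - X) ∈ K :=
  hK.add_smul_sub_mem hX hV ht

/-- The descent lemma. The curvature term involves the nuclear norm because the gradient is
Lipschitz from the nuclear norm to its dual, the operator norm. -/
theorem NuclearProblem.descent (hP : NuclearProblem s f g R β α₂) {X V : Mat m n}
    (hX : X ∈ nuclearBall m n R) (hV : V ∈ nuclearBall m n R) {t : ℝ} (ht : t ∈ Icc (0 : ℝ) 1) :
    f (X + t • (V - X)) ≤
      f X + t * dot (V - X) (g X) + β * t ^ 2 / 2 * nuclearNorm (V - X) ^ 2 := by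
  set D := V - X
  set N := nuclearNorm D
  have hN : 0 ≤ N := nuclearNorm_nonneg D
  have hmem : ∀ u ∈ Icc (0 : ℝ) 1, X + u • D ∈ nuclearBall m n R := fun u hu =>
    add_smul_sub_mem hP.convex.1 hX hV hu
  let ψ : ℝ → ℝ := fun u => f (X + u • D) - u * dot D (g X) - β * u ^ 2 / 2 * N ^ 2
  have hψ : ∀ u ∈ Icc (0 : ℝ) 1,
      HasDerivAt ψ (dot (g (X + u • D)) D - dot D (g X) - β * u * N ^ 2) u := fun u hu => by
    have h1 := (hP.gradient _ (hmem u hu)).hasDerivAt_line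
    have h2 := (hasDerivAt_id u).mul_const (dot D (g X))
    have h3 := (((hasDerivAt_pow 2 u).const_mul β).div_const 2).mul_const (N ^ 2)
    refine ((h1.sub h2).sub h3).congr_deriv ?_
    push_cast
    ring
  have hanti : AntitoneOn ψ (Icc 0 1) := by
    refine antitoneOn_of_deriv_nonpos (convex_Icc 0 1)
      (fun u hu => (hψ u hu).continuousAt.continuousWithinAt)
      (fun u hu => (hψ u (interior_subset hu)).differentiableAt.differentiableWithinAt)
      fun u hu => ?_
    have hu' := interior_subset hu
    rw [(hψ u hu').deriv, dot_comm D, ← dot_sub_left]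
    have h1 := dot_le_opNorm_mul_nuclearNorm (g (X + u • D) - g X) D
    have h2 := hP.lipschitz _ (hmem u hu') X hX
    rw [add_sub_cancel_left] at h2
    have h3 := mul_le_mul_of_nonneg_left (nuclearNorm_smul_le hu'.1 D) hP.β_pos.le
    have h4 := mul_le_mul_of_nonneg_right (h2.trans h3) hN
    have e : β * (u * N) * N = β * u * N ^ 2 := by ring
    linarith
  have h := hanti (left_mem_Icc.mpr zero_le_one) ht ht.1
  simp only [ψ, zero_smul, add_zero] at h
  linarith

/-- The first-order characterization of convexity. -/
theorem NuclearProblem.dot_le_sub (hP : NuclearProblem s f g R β α₂) {X V : Mat m n}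
    (hX : X ∈ nuclearBall m n R) (hV : V ∈ nuclearBall m n R) :
    dot (V - X) (g X) ≤ f V - f X := by
  have hconv : ConvexOn ℝ (Icc (0 : ℝ) 1) fun t : ℝ => f (X + t • (V - X)) := by
    refine ⟨convex_Icc 0 1, fun a ha b hb p q hp hq hpq => ?_⟩
    have h := hP.convex.2 (add_smul_sub_mem hP.convex.1 hX hV ha)
      (add_smul_sub_mem hP.convex.1 hX hV hb) hp hq hpq
    convert h using 2
    rw [smul_add, smul_add, smul_smul, smul_smul, add_add_add_comm, ← add_smul, ← add_smul, hpq,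
      one_smul, smul_eq_mul, smul_eq_mul]
  have hg : HasDerivAt (fun t : ℝ => f (X + t • (V - X))) (dot (g X) (V - X)) 0 := by
    refine IsGradientAt.hasDerivAt_line ?_
    rw [zero_smul, add_zero]
    exact hP.gradient X hX
  have h := hconv.le_slope_of_hasDerivAt (left_mem_Icc.mpr zero_le_one)
    (right_mem_Icc.mpr zero_le_one) zero_lt_one hg
  rw [dot_comm]
  simpa [slope] using h

theorem optVal_eq_of_mem_argminOn {Xs : Mat m n}
    (h : Xs ∈ argminOn f (nuclearBall m n R)) : optVal f (nuclearBall m n R) = f Xs :=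
  IsLeast.csInf_eq ⟨⟨Xs, h.1, rfl⟩, by rintro _ ⟨Y, hY, rfl⟩; exact h.2 Y hY⟩

theorem NuclearProblem.optVal_le (hP : NuclearProblem s f g R β α₂) {X : Mat m n}
    (hX : X ∈ nuclearBall m n R) : optVal f (nuclearBall m n R) ≤ f X := by
  obtain ⟨Xs, hXs, -⟩ := hP.growth X hX
  rw [optVal_eq_of_mem_argminOn hXs]
  exact hXs.2 X hX

theorem stepSize_eq_div (s β α₂ : ℝ) :
    stepSize s (8 * s) β α₂ = α₂ / (64 * β * s) := by
  rw [stepSize]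
  congr 1
  ring

theorem NuclearProblem.stepSize_pos (hP : NuclearProblem s f g R β α₂) :
    0 < stepSize s (8 * s) β α₂ := by
  have h1 : (0 : ℝ) < s := by exact_mod_cast hP.one_le_s
  have := hP.β_pos
  have := hP.α₂_pos
  rw [stepSize_eq_div]
  positivity

/-- A step of length `η` contracts the optimality gap. The point `V` is compared with a nearby
optimal solution, and the curvature term is split at the thresholded iterate, which is a best
approximation of `X` both in the nuclear and in the Euclidean norm. -/
theorem NuclearProblem.step_contraction (hP : NuclearProblem s f g R β α₂) {η : ℝ}
    (hη : η = stepSize s (8 * s) β α₂) (hη1 : η ≤ 1) {X Xhat V : Mat m n}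
    (hX : X ∈ nuclearBall m n R)
    (hXhat : Xhat ∈ argminOn (fun y => frobNorm (y - X)) (lowRank m n s))
    (hV : V ∈ argminOn (fun w => dot (w - X) (g X) + 2 * s * β * η * frobNorm (w - Xhat) ^ 2)
      (nuclearBall m n R ∩ lowRank m n s)) :
    f ((1 - η) • X + η • V) - optVal f (nuclearBall m n R) ≤
      (1 - η / 2) * (f X - optVal f (nuclearBall m n R)) := by
  have hS := hP.sparsityAssumption
  have hη0 : 0 < η := hη ▸ hP.stepSize_pos
  have hs1 : (1 : ℝ) ≤ s := hS.one_le_s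
  have hβ := hP.β_pos
  have hα := hP.α₂_pos
  obtain ⟨Xs, hXs, hgrow⟩ := hP.growth X hX
  rw [optVal_eq_of_mem_argminOn hXs]
  have hXsR : Xs ∈ lowRank m n s := hP.rank_opt Xs hXs
  have e : (1 - η) • X + η • V = X + η • (V - X) := by
    rw [sub_smul, one_smul, smul_sub]; abel
  have hdesc := hP.descent hX hV.1.1 (t := η) ⟨hη0.le, hη1⟩
  have hprox := hV.2 Xs ⟨hXs.1, hXsR⟩
  have hconv := hP.dot_le_sub hX hXs.1
  set d := frobNorm (X - Xs) with hd
  -- the nuclear distance from `X` to its thresholding is at most the one to `Xs`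
  have hXhatN : Xhat ∈ argminOn (fun y => nuclearNorm (y - X)) (lowRank m n s) := by
    rw [hS.argmin_eq X hX]; exact hXhat
  have hb : nuclearNorm (Xhat - X) ^ 2 ≤ 8 * s * d ^ 2 := by
    have h1 : nuclearNorm (Xhat - X) ≤ Real.sqrt (8 * s) * d := by
      refine (hXhatN.2 Xs hXsR).trans ?_
      simp only [nuclearNorm_sub_comm Xs X]
      exact hS.norm_le_opt X hX Xs hXs
    have h2 := pow_le_pow_left₀ (nuclearNorm_nonneg _) h1 2
    rwa [mul_pow, Real.sq_sqrt (by positivity)] at h2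
  have ha : nuclearNorm (V - Xhat) ^ 2 ≤ 2 * s * frobNorm (V - Xhat) ^ 2 := by
    have h2 := pow_le_pow_left₀ (nuclearNorm_nonneg _)
      (hS.norm_le_sparse V hV.1.2 Xhat hXhat.1) 2
    rwa [mul_pow, Real.sq_sqrt (by positivity)] at h2
  have hc : nuclearNorm (V - X) ^ 2 ≤
      2 * nuclearNorm (V - Xhat) ^ 2 + 2 * nuclearNorm (Xhat - X) ^ 2 := by
    have h1 : nuclearNorm (V - X) ≤ nuclearNorm (V - Xhat) + nuclearNorm (Xhat - X) := by
      simpa using nuclearNorm_add_le (V - Xhat) (Xhat - X)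
    nlinarith [pow_le_pow_left₀ (nuclearNorm_nonneg _) h1 2,
      sq_nonneg (nuclearNorm (V - Xhat) - nuclearNorm (Xhat - X))]
  -- parallelogram law, with `Xhat` at most as far from `X` as `Xs`
  have hdist : frobNorm (Xs - Xhat) ^ 2 ≤ 4 * d ^ 2 := by
    have h1 : dot (Xhat - X) (Xhat - X) ≤ d ^ 2 := by
      have h := hXhat.2 Xs hXsR
      simp only [frobNorm_sub_comm Xs X] at h
      rw [hd, ← frobNorm_sq]
      exact pow_le_pow_left₀ (frobNorm_nonneg _) h 2
    have h2 : dot (Xs - X) (Xs - X) = d ^ 2 := by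
      rw [hd, frobNorm_sub_comm, frobNorm_sq]
    have h3 := dot_self_nonneg ((Xs - X) + (Xhat - X))
    have h4 : Xs - Xhat = (Xs - X) - (Xhat - X) := by abel
    rw [frobNorm_sq, h4]
    generalize Xs - X = A at h2 h3 ⊢
    generalize Xhat - X = B at h1 h3 ⊢
    rw [dot_add_left, dot_add_right, dot_add_right] at h3
    rw [dot_sub_left, dot_sub_right, dot_sub_right]
    linarith [dot_comm A B]
  have hηmul : η * (64 * β * s) = α₂ := by
    rw [hη, stepSize_eq_div]
    field_simp
  have hgrow' : α₂ * d ^ 2 ≤ 2 * (f X - f Xs) := by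
    have := mul_le_mul_of_nonneg_left hgrow hα.le
    have e2 : α₂ * (2 / α₂ * (f X - f Xs)) = 2 * (f X - f Xs) := by field_simp
    linarith
  have hcurv : β * η ^ 2 / 2 * nuclearNorm (V - X) ^ 2 ≤
      η * (2 * s * β * η * frobNorm (V - Xhat) ^ 2) + 8 * β * s * η ^ 2 * d ^ 2 := by
    have h0 : 0 ≤ β * η ^ 2 / 2 := by positivity
    have h1 := mul_le_mul_of_nonneg_left (hc.trans
      (add_le_add (mul_le_mul_of_nonneg_left ha zero_le_two)
        (mul_le_mul_of_nonneg_left hb zero_le_two))) h0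
    refine h1.trans_eq ?_
    ring
  have hprox' := mul_le_mul_of_nonneg_left hprox hη0.le
  have hconv' := mul_le_mul_of_nonneg_left hconv hη0.le
  have hdist' := mul_le_mul_of_nonneg_left hdist
    (show 0 ≤ η * (2 * s * β * η) by positivity)
  have hgrow'' := mul_le_mul_of_nonneg_left hgrow' hη0.le
  have e3 : η * (α₂ * d ^ 2) = 64 * β * s * η ^ 2 * d ^ 2 := by
    rw [← hηmul]; ring
  rw [e]
  simp only [mul_add] at hprox'
  linarith

theorem NuclearProblem.run_contraction (hP : NuclearProblem s f g R β α₂) {η : ℝ}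
    (hη : η = stepSize s (8 * s) β α₂) (hη1 : η ≤ 1) {x xhat v : ℕ → Mat m n} {γ : ℕ → ℝ}
    (hrun : IsRun g (nuclearBall m n R) (lowRank m n s) s β η x xhat v γ)
    (hstep : StepRule f η x v γ) (k : ℕ) :
    x k ∈ nuclearBall m n R ∧
      f (x k) - optVal f (nuclearBall m n R) ≤
        (1 - η / 2) ^ k * (f (x 0) - optVal f (nuclearBall m n R)) := by
  have hη0 : 0 < η := hη ▸ hP.stepSize_pos
  induction k with
  | zero => exact ⟨hrun.init, by simp⟩
  | succ k ih =>
    obtain ⟨hx, hle⟩ := ih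
    constructor
    · rw [hrun.update k]
      exact hP.convex.1 hx (hrun.prox k).1.1 (sub_nonneg.mpr (hrun.step_mem k).2)
        (hrun.step_mem k).1 (by ring)
    · have h1 : f (x (k + 1)) ≤ f ((1 - η) • x k + η • v k) := by
        rw [hrun.update k]
        rcases hstep k with h | h
        · rw [h]
        · exact h.2 η ⟨hη0.le, hη1⟩
      have h2 := hP.step_contraction hη hη1 hx (hrun.threshold k) (hrun.prox k)
      have h3 := mul_le_mul_of_nonneg_left hle (show 0 ≤ 1 - η / 2 by linarith)
      rw [pow_succ']
      linarith

theorem NuclearProblem.gap_le_exp (hP : NuclearProblem s f g R β α₂) {η : ℝ}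
    (hη : η = stepSize s (8 * s) β α₂) (hη1 : η ≤ 1) {x xhat v : ℕ → Mat m n} {γ : ℕ → ℝ}
    (hrun : IsRun g (nuclearBall m n R) (lowRank m n s) s β η x xhat v γ)
    (hstep : StepRule f η x v γ) (k : ℕ) :
    f (x k) - optVal f (nuclearBall m n R) ≤
      (f (x 0) - optVal f (nuclearBall m n R)) * Real.exp (-(η / 2 * k)) := by
  have hη0 : 0 < η := hη ▸ hP.stepSize_pos
  have h0 : 0 ≤ f (x 0) - optVal f (nuclearBall m n R) := sub_nonneg.mpr (hP.optVal_le hrun.init)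
  refine (hP.run_contraction hη hη1 hrun hstep k).2.trans ?_
  rw [mul_comm]
  refine mul_le_mul_of_nonneg_left ?_ h0
  rw [show -(η / 2 * k) = k * -(η / 2) by ring, Real.exp_nat_mul]
  refine pow_le_pow_left₀ (by linarith) ?_ k
  linarith [Real.add_one_le_exp (-(η / 2))]

theorem NuclearProblem.iteration_complexity (hP : NuclearProblem s f g R β α₂) {η : ℝ}
    (hη : η = stepSize s (8 * s) β α₂) (hη1 : η ≤ 1) {x xhat v : ℕ → Mat m n} {γ : ℕ → ℝ}
    (hrun : IsRun g (nuclearBall m n R) (lowRank m n s) s β η x xhat v γ)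
    (hstep : StepRule f η x v γ) {ε : ℝ} (hε : 0 < ε) :
    (∀ k : ℕ, 256 * (β * s / α₂) *
        Real.log ((f (x 0) - optVal f (nuclearBall m n R)) / ε) ≤ k →
      f (x k) - optVal f (nuclearBall m n R) ≤ ε) ∧
    (ε * (f (x 0) - optVal f (nuclearBall m n R)) ≤ 1 →
      ∀ k : ℕ, 256 * (β * s / α₂) * Real.log (1 / ε) ≤ k →
      f (x k) - optVal f (nuclearBall m n R) ≤ ε) := by
  have hη0 : 0 < η := hη ▸ hP.stepSize_pos
  have hs0 : (0 : ℝ) < s := by exact_mod_cast hP.one_le_s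
  have hβ := hP.β_pos
  have hα := hP.α₂_pos
  have h0 : 0 ≤ f (x 0) - optVal f (nuclearBall m n R) := sub_nonneg.mpr (hP.optVal_le hrun.init)
  have hgap := hP.gap_le_exp hη hη1 hrun hstep
  set h := f (x 0) - optVal f (nuclearBall m n R)
  -- a bound `256 (β s / α₂) l ≤ k` on the number of iterations is `2 l ≤ (η / 2) k`
  have hk : ∀ (l : ℝ) (k : ℕ), 256 * (β * s / α₂) * l ≤ k → 2 * l ≤ η / 2 * k := fun l k hlk => by
    have h1 := mul_le_mul_of_nonneg_left hlk (show 0 ≤ η / 2 by positivity)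
    have h2 : η / 2 * (256 * (β * s / α₂) * l) = 2 * l := by
      rw [hη, stepSize_eq_div]
      field_simp
      ring
    linarith
  constructor
  · intro k hlk
    have hlk' := hk _ k hlk
    refine (hgap k).trans ?_
    have hexp1 : Real.exp (-(η / 2 * k)) ≤ 1 := by
      rw [Real.exp_le_one_iff]
      have : 0 ≤ η / 2 * k := by positivity
      linarith
    rcases le_total h ε with hle | hle
    · exact (mul_le_of_le_one_right h0 hexp1).trans hle
    · have hpos : 0 < h := hε.trans_le hle
      have hlog : 0 ≤ Real.log (h / ε) := Real.log_nonneg ((one_le_div hε).mpr hle)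
      calc h * Real.exp (-(η / 2 * k)) ≤ h * Real.exp (-Real.log (h / ε)) := by
            gcongr
            linarith
        _ = ε := by
            rw [Real.exp_neg, Real.exp_log (by positivity)]
            field_simp
  · intro hεh k hlk
    have hlk' := hk _ k hlk
    calc f (x k) - optVal f (nuclearBall m n R) ≤ h * Real.exp (-(η / 2 * k)) := hgap k
      _ ≤ 1 / ε * Real.exp (-(2 * Real.log (1 / ε))) := by
          refine mul_le_mul ?_ (Real.exp_le_exp.mpr (by linarith)) (Real.exp_pos _).le
            (by positivity)
          rw [le_div_iff₀ hε, mul_comm]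
          exact hεh
      _ = ε := by
          rw [two_mul, neg_add, Real.exp_add, Real.exp_neg, Real.exp_log (by positivity)]
          field_simp

end Convergence

/-! ### Projection onto low-rank matrices in the nuclear norm ball -/

section Projection

open Matrix

variable {m n s : ℕ}

theorem isFullSVD_softThreshold {Z : Mat m n} {D : SVDData m n (min m n)} (h : IsFullSVD Z D)
    (τ : ℝ) :
    IsFullSVD (D.U * Matrix.diagonal (fun j => max (D.σ j - τ) 0) * D.Vᵀ)
      ⟨D.U, fun j => max (D.σ j - τ) 0, D.V⟩ :=
  ⟨h.orthoU, h.orthoV, fun _ => le_max_right _ _,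
    fun _ _ hij => max_le_max (sub_le_sub_right (h.anti hij) τ) le_rfl, rfl⟩

theorem max_sub_mul_min (a τ : ℝ) : max (a - τ) 0 * min a τ = τ * max (a - τ) 0 := by
  rcases le_total a τ with h | h
  · rw [max_eq_right (by linarith)]; ring
  · rw [min_eq_right h]; ring

/-- The Euclidean projection onto the matrices of rank at most `s` in the nuclear norm ball: keep
`s` singular values and soft-threshold them at the level `τ` which projects them onto the simplex.
Indeed `Z = Zτ + W`, where `Zτ` is the soft-thresholding of all of `Z` and `W` has operator norm at
most `τ`; the projection is a best rank-`s` approximation of `Zτ` and maximizes the pairing with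
`W` over the ball. -/
theorem IsFullSVD.dot_projection_le {Z : Mat m n} {D : SVDData m n (min m n)} (h : IsFullSVD Z D)
    (hs : s ≤ min m n) {R τ : ℝ} (hτ : 0 ≤ τ)
    (hcomp : τ = 0 ∨ ∑ j : Fin s, max (D.σ (Fin.castLE hs j) - τ) 0 = R) {P : Mat m n}
    (hP : P = headCols hs D.U * Matrix.diagonal (fun j => max (D.σ (Fin.castLE hs j) - τ) 0) *
      (headCols hs D.V)ᵀ)
    {V : Mat m n} (hV : V.rank ≤ s) (hVR : nuclearNorm V ≤ R) :
    dot (P - Z) (P - Z) ≤ dot (V - Z) (V - Z) := by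
  set Zτ := D.U * Matrix.diagonal (fun j => max (D.σ j - τ) 0) * D.Vᵀ with hZτ
  set W := D.U * Matrix.diagonal (fun j => min (D.σ j) τ) * D.Vᵀ with hW
  have hfull := isFullSVD_softThreshold h τ
  have hsplit : Z = Zτ + W := by
    rw [hZτ, hW, ← Matrix.add_mul, ← Matrix.mul_add, diagonal_add]
    conv_lhs => rw [h.eq]
    congr 3
    funext j
    rcases le_total (D.σ j) τ with hj | hj
    · rw [max_eq_right (by linarith), min_eq_left hj, zero_add]
    · rw [max_eq_left (by linarith), min_eq_right hj, sub_add_cancel]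
  have hopt : dot (Zτ - P) (Zτ - P) ≤ dot (Zτ - V) (Zτ - V) := by
    rw [hfull.dot_sub_headCols hs hP]
    exact sum_sv_sq_le_dot_sub Zτ hV
  have hWn : opNorm W ≤ τ := opNorm_svd_le h.orthoU h.orthoV hτ fun j => by
    rw [abs_of_nonneg (le_min (h.nonneg j) hτ)]
    exact min_le_right _ _
  have hVW : dot V W ≤ τ * R := by
    rw [dot_comm]
    exact (dot_le_opNorm_mul_nuclearNorm W V).trans
      (mul_le_mul hWn hVR (nuclearNorm_nonneg V) hτ)
  have hPW : dot P W = τ * R := by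
    rw [hP, headCols_svd hs D.U D.V (fun j => max (D.σ j - τ) 0), hW,
      dot_svd_svd h.orthoU h.orthoV]
    have e : τ * ∑ j : Fin s, max (D.σ (Fin.castLE hs j) - τ) 0 = τ * R := by
      rcases hcomp with h0 | h0
      · rw [h0]; simp
      · rw [h0]
    rw [← e, sum_castLE hs (fun j => max (D.σ j - τ) 0), Finset.mul_sum]
    refine Finset.sum_congr rfl fun j _ => ?_
    split_ifs
    · exact max_sub_mul_min _ _
    · simp
  clear_value Zτ W
  have hexpand : ∀ Y : Mat m n, dot (Y - Z) (Y - Z) =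
      dot (Zτ - Y) (Zτ - Y) - 2 * dot Y W + (2 * dot Zτ W + dot W W) := fun Y => by
    rw [hsplit]
    simp only [dot_sub_left, dot_sub_right, dot_add_left, dot_add_right]
    linarith [dot_comm Y Zτ, dot_comm Y W, dot_comm W Zτ]
  rw [hexpand P, hexpand V]
  linarith

/-- For sorted values, the part above the level `τ` is a partial sum. -/
theorem exists_sum_max_eq {σ : ℕ → ℝ} {s : ℕ} (hσ : ∀ i j, i ≤ j → j < s → σ j ≤ σ i) (τ : ℝ) :
    ∃ k ≤ s, ∑ j ∈ Finset.range s, max (σ j - τ) 0 = ∑ j ∈ Finset.range k, σ j - k * τ := by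
  induction s with
  | zero => exact ⟨0, le_rfl, by simp⟩
  | succ s ih =>
    by_cases h : σ s ≤ τ
    · obtain ⟨k, hk, e⟩ := ih fun i j hij hj => hσ i j hij (by omega)
      refine ⟨k, by omega, ?_⟩
      rw [Finset.sum_range_succ, e, max_eq_right (by linarith), add_zero]
    · refine ⟨s + 1, le_rfl, ?_⟩
      have : ∀ j ∈ Finset.range (s + 1), max (σ j - τ) 0 = σ j - τ := fun j hj => by
        have := hσ j s (by simpa [Nat.lt_succ_iff] using hj) (by omega)
        exact max_eq_left (by linarith)
      rw [Finset.sum_congr rfl this, Finset.sum_sub_distrib]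
      simp

/-- `τ` is the level computed by a scan of the first `k` partial sums of `σ`: the maximum of `0`
and of `(σ 0 + ⋯ + σ (j - 1) - R) / j` for `1 ≤ j ≤ k`. -/
structure IsScanLevel (σ : ℕ → ℝ) (R : ℝ) (k : ℕ) (τ : ℝ) : Prop where
  nonneg : 0 ≤ τ
  le : ∀ j, 1 ≤ j → j ≤ k → ∑ i ∈ Finset.range j, σ i - R ≤ j * τ
  attained : τ = 0 ∨ ∃ j, j ≤ k ∧ ∑ i ∈ Finset.range j, σ i - R = j * τ

theorem isScanLevel_zero (σ : ℕ → ℝ) (R : ℝ) : IsScanLevel σ R 0 0 :=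
  ⟨le_rfl, fun j h1 h2 => by omega, .inl rfl⟩

theorem IsScanLevel.succ {σ : ℕ → ℝ} {R : ℝ} {k : ℕ} {τ : ℝ} (h : IsScanLevel σ R k τ) :
    IsScanLevel σ R (k + 1)
      (if τ ≤ (∑ i ∈ Finset.range (k + 1), σ i - R) / ((k : ℝ) + 1)
        then (∑ i ∈ Finset.range (k + 1), σ i - R) / ((k : ℝ) + 1) else τ) := by
  have hk : (0 : ℝ) < (k : ℝ) + 1 := by positivity
  set t := (∑ i ∈ Finset.range (k + 1), σ i - R) / ((k : ℝ) + 1) with ht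
  have ht' : ∑ i ∈ Finset.range (k + 1), σ i - R = ((k + 1 : ℕ) : ℝ) * t := by
    rw [ht]; push_cast; field_simp
  split_ifs with hle
  · refine ⟨h.nonneg.trans hle, fun j h1 h2 => ?_, .inr ⟨k + 1, le_rfl, ht'⟩⟩
    rcases Nat.lt_or_ge k j with hj | hj
    · obtain rfl : j = k + 1 := by omega
      exact ht'.le
    · exact (h.le j h1 hj).trans (mul_le_mul_of_nonneg_left hle (Nat.cast_nonneg j))
  · refine ⟨h.nonneg, fun j h1 h2 => ?_, h.attained.imp_right fun ⟨j, hj, e⟩ =>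
      ⟨j, by omega, e⟩⟩
    rcases Nat.lt_or_ge k j with hj | hj
    · obtain rfl : j = k + 1 := by omega
      rw [ht']
      exact mul_le_mul_of_nonneg_left (not_le.mp hle).le (Nat.cast_nonneg _)
    · exact h.le j h1 hj

/-- Soft-thresholding sorted values at the scan level projects them onto `{p ≥ 0, ∑ p ≤ R}`. -/
theorem IsScanLevel.sum_max {σ : ℕ → ℝ} {R : ℝ} {s : ℕ} {τ : ℝ} (h : IsScanLevel σ R s τ)
    (hR : 0 ≤ R) (hσ : ∀ i j, i ≤ j → j < s → σ j ≤ σ i) :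
    ∑ j ∈ Finset.range s, max (σ j - τ) 0 ≤ R ∧
      (τ = 0 ∨ ∑ j ∈ Finset.range s, max (σ j - τ) 0 = R) := by
  have hle : ∑ j ∈ Finset.range s, max (σ j - τ) 0 ≤ R := by
    obtain ⟨k, hk, e⟩ := exists_sum_max_eq hσ τ
    rw [e]
    rcases Nat.eq_zero_or_pos k with rfl | h1
    · simpa using hR
    · linarith [h.le k h1 hk]
  refine ⟨hle, h.attained.imp_right fun ⟨k, hk, e⟩ => le_antisymm hle ?_⟩
  calc R = ∑ j ∈ Finset.range k, (σ j - τ) := by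
        rw [Finset.sum_sub_distrib]
        simp
        linarith
    _ ≤ ∑ j ∈ Finset.range k, max (σ j - τ) 0 := Finset.sum_le_sum fun _ _ => le_max_left _ _
    _ ≤ ∑ j ∈ Finset.range s, max (σ j - τ) 0 :=
        Finset.sum_le_sum_of_subset_of_nonneg (Finset.range_subset_range.mpr hk)
          fun _ _ _ => le_max_right _ _

/-- Completing the square in the objective of the sparse proximal step, with `c = 4 s β η`. -/
theorem prox_objective_eq {c : ℝ} (hc : c ≠ 0) (X Xhat G w : Mat m n) :
    dot (w - X) G + c / 2 * frobNorm (w - Xhat) ^ 2 =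
      c / 2 * dot (w - (Xhat - (1 / c) • G)) (w - (Xhat - (1 / c) • G)) +
        (dot (Xhat - X) G - 1 / (2 * c) * dot G G) := by
  rw [frobNorm_sq]
  have e1 : w - X = (w - Xhat) + (Xhat - X) := by abel
  have e2 : w - (Xhat - (1 / c) • G) = (w - Xhat) + (1 / c) • G := by abel
  rw [e1, e2]
  generalize w - Xhat = A
  simp only [dot_add_left, dot_add_right, dot_smul_left, dot_smul_right]
  rw [dot_comm G A]
  field_simp
  ring

/-- The thresholding step computed from a rank-`s` SVD. -/
theorem IsTopSVD.mem_argminOn_frobNorm {hs : s ≤ min m n} {X : Mat m n} {D : SVDData m n s}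
    (h : IsTopSVD hs X D) :
    D.U * Matrix.diagonal D.σ * D.Vᵀ ∈
      argminOn (fun y => frobNorm (y - X)) (lowRank m n s) := by
  obtain ⟨F, hF, hU, hσ, hV⟩ := h
  refine hF.headCols_mem_argminOn hs ?_
  rw [show D.U = headCols hs F.U from Matrix.ext hU, show D.V = headCols hs F.V from Matrix.ext hV,
    show D.σ = fun j => F.σ (Fin.castLE hs j) from funext hσ]

/-- The sparse proximal step computed from a rank-`s` SVD. The singular values are indexed by all
naturals here; only the first `s` of them matter. -/
theorem IsTopSVD.mem_argminOn_prox {hs : s ≤ min m n} {c R τ : ℝ} (hc : 0 < c) (hR : 0 ≤ R)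
    {X Xhat G : Mat m n} {D : SVDData m n s} (h : IsTopSVD hs (Xhat - (1 / c) • G) D)
    {σ : ℕ → ℝ} (hσD : ∀ j : Fin s, σ j = D.σ j) (hτ : IsScanLevel σ R s τ) :
    D.U * Matrix.diagonal (fun j : Fin s => max (σ j - τ) 0) * D.Vᵀ ∈
      argminOn (fun w => dot (w - X) G + c / 2 * frobNorm (w - Xhat) ^ 2)
        (nuclearBall m n R ∩ lowRank m n s) := by
  obtain ⟨F, hF, hU, hσ, hV⟩ := h
  have hσF : ∀ j : Fin s, σ j = F.σ (Fin.castLE hs j) := fun j => (hσD j).trans (hσ j)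
  have hanti : ∀ i j, i ≤ j → j < s → σ j ≤ σ i := fun i j hij hj => by
    have h1 := hσF ⟨i, hij.trans_lt hj⟩
    have h2 := hσF ⟨j, hj⟩
    simp only at h1 h2
    rw [h1, h2]
    exact hF.anti hij
  obtain ⟨hsum, hcomp⟩ := hτ.sum_max hR hanti
  rw [← Fin.sum_univ_eq_sum_range (fun j => max (σ j - τ) 0)] at hsum hcomp
  simp only [hσF] at hsum hcomp ⊢
  rw [show D.U = headCols hs F.U from Matrix.ext hU, show D.V = headCols hs F.V from Matrix.ext hV]
  refine ⟨⟨?_, rank_svd_le _ _ _⟩, fun w hw => ?_⟩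
  · change nuclearNorm _ ≤ R
    rwa [nuclearNorm_svd (headCols_ortho hs hF.orthoU) (headCols_ortho hs hF.orthoV)
      fun _ => le_max_right _ _]
  · simp only [prox_objective_eq hc.ne']
    have := mul_le_mul_of_nonneg_left
      (hF.dot_projection_le hs hτ.nonneg hcomp rfl hw.2 hw.1) (half_pos hc).le
    linarith

end Projection

/-! ### Semantics and cost of programs -/

section Semantics

variable {m n s : ℕ}

/-- The effect of a program on the memory alone. The conditional is taken cell by cell, so that
reading a cell after a conditional unfolds to a conditional between reals. -/
noncomputable def Prog.eval (g : Mat m n → Mat m n) (svdOracle : Mat m n → SVDData m n s) :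
    Prog → (ℕ → ℕ) → Memory → Memory
  | .skip, _, μ => μ
  | .const dst c, env, μ => writeCell env μ dst (c : ℝ)
  | .arith o dst a b, env, μ => writeCell env μ dst (o.val (readCell env μ a) (readCell env μ b))
  | .seq p q, env, μ => q.eval g svdOracle env (p.eval g svdOracle env μ)
  | .ifLE a b p q, env, μ => fun c i j =>
      if readCell env μ a ≤ readCell env μ b then p.eval g svdOracle env μ c i j
      else q.eval g svdOracle env μ c i j
  | .loop v d body, env, μ =>
      (List.range (d.val m n s)).foldl
        (fun ν k => body.eval g svdOracle (Function.update env v k) ν) μ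
  | .grad src dst, _, μ => writeMat μ dst (g (readMat m n μ src))
  | .svd src aU aσ aV, _, μ => writeSVD μ aU aσ aV (svdOracle (readMat m n μ src))

/-- A bound on the number of elementary operations: both branches of a conditional are counted. -/
def Prog.cost (m n s : ℕ) : Prog → ℕ
  | .skip => 0
  | .const _ _ => 1
  | .arith _ _ _ _ => 1
  | .seq p q => p.cost m n s + q.cost m n s
  | .ifLE _ _ p q => 1 + p.cost m n s + q.cost m n s
  | .loop _ d body => 1 + d.val m n s * (1 + body.cost m n s)
  | .grad _ _ => 0
  | .svd _ _ _ _ => 0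

/-- The program makes no oracle calls. -/
def Prog.OracleFree : Prog → Prop
  | .skip => True
  | .const _ _ => True
  | .arith _ _ _ _ => True
  | .seq p q => p.OracleFree ∧ q.OracleFree
  | .ifLE _ _ p q => p.OracleFree ∧ q.OracleFree
  | .loop _ _ body => body.OracleFree
  | .grad _ _ => False
  | .svd _ _ _ _ => False

variable (g : Mat m n → Mat m n) (svdOracle : Mat m n → SVDData m n s)

theorem Prog.mem_exec (p : Prog) (env : ℕ → ℕ) (st : State) :
    (p.exec g svdOracle env st).mem = p.eval g svdOracle env st.mem := by
  induction p generalizing env st with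
  | seq p q hp hq => rw [Prog.exec, Prog.eval, hq, hp]
  | ifLE a b p q hp hq =>
    rw [Prog.exec, Prog.eval]
    funext c i j
    split_ifs
    exacts [congrFun₃ (hp _ _) c i j, congrFun₃ (hq _ _) c i j]
  | loop v d body ih =>
    rw [Prog.exec, Prog.eval]
    generalize List.range (d.val m n s) = l
    suffices h : ∀ st' : State, (l.foldl (fun st' k => body.exec g svdOracle
        (Function.update env v k) { st' with ops := st'.ops + 1 }) st').mem =
        l.foldl (fun ν k => body.eval g svdOracle (Function.update env v k) ν) st'.mem from h _
    induction l with
    | nil => exact fun _ => rfl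
    | cons k l ihl => exact fun st' => by rw [List.foldl_cons, List.foldl_cons, ihl, ih]
  | _ => rfl

theorem Prog.ops_exec_le (p : Prog) (env : ℕ → ℕ) (st : State) :
    (p.exec g svdOracle env st).ops ≤ st.ops + p.cost m n s := by
  induction p generalizing env st with
  | seq p q hp hq =>
    rw [Prog.exec, Prog.cost]
    have h1 := hp env st
    have h2 := hq env (p.exec g svdOracle env st)
    omega
  | ifLE a b p q hp hq =>
    rw [Prog.exec, Prog.cost]
    split_ifs
    · have h := hp env { st with ops := st.ops + 1 }
      simp only at h
      omega
    · have h := hq env { st with ops := st.ops + 1 }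
      simp only at h
      omega
  | loop v d body ih =>
    rw [Prog.exec, Prog.cost]
    suffices h : ∀ (l : List ℕ) (st' : State), (l.foldl (fun st' k => body.exec g svdOracle
        (Function.update env v k) { st' with ops := st'.ops + 1 }) st').ops ≤
        st'.ops + l.length * (1 + body.cost m n s) by
      have h' := h (List.range (d.val m n s)) { st with ops := st.ops + 1 }
      rw [List.length_range] at h'
      simp only at h'
      omega
    intro l
    induction l with
    | nil => exact fun _ => by simp
    | cons k l ihl =>
      intro st'
      have h1 := ih (Function.update env v k) { st' with ops := st'.ops + 1 }
      have h2 := ihl (body.exec g svdOracle (Function.update env v k)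
        { st' with ops := st'.ops + 1 })
      rw [List.foldl_cons, List.length_cons, add_mul]
      simp only at h1
      omega
  | _ => simp [Prog.exec, Prog.cost]

theorem Prog.OracleFree.exec {p : Prog} (h : p.OracleFree) (env : ℕ → ℕ) (st : State) :
    (p.exec g svdOracle env st).grads = st.grads ∧
      (p.exec g svdOracle env st).svds = st.svds := by
  induction p generalizing env st with
  | seq p q hp hq =>
    rw [Prog.exec]
    have h1 := hp h.1 env st
    have h2 := hq h.2 env (p.exec g svdOracle env st)
    exact ⟨h2.1.trans h1.1, h2.2.trans h1.2⟩
  | ifLE a b p q hp hq =>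
    rw [Prog.exec]
    split_ifs
    exacts [hp h.1 _ _, hq h.2 _ _]
  | loop v d body ih =>
    rw [Prog.exec]
    generalize List.range (d.val m n s) = l
    suffices h' : ∀ st' : State,
        (l.foldl (fun st' k => body.exec g svdOracle (Function.update env v k)
          { st' with ops := st'.ops + 1 }) st').grads = st'.grads ∧
        (l.foldl (fun st' k => body.exec g svdOracle (Function.update env v k)
          { st' with ops := st'.ops + 1 }) st').svds = st'.svds from h' _
    induction l with
    | nil => exact fun _ => ⟨rfl, rfl⟩
    | cons k l ihl =>
      intro st'
      rw [List.foldl_cons]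
      have h1 := ih h (Function.update env v k) { st' with ops := st'.ops + 1 }
      have h2 := ihl (body.exec g svdOracle (Function.update env v k)
        { st' with ops := st'.ops + 1 })
      exact ⟨h2.1.trans h1.1, h2.2.trans h1.2⟩
  | grad => exact h.elim
  | svd => exact h.elim
  | _ => exact ⟨rfl, rfl⟩

/-- Reasoning about a loop by an invariant. -/
theorem Prog.eval_loop_induction {v : ℕ} {d : Bound} {body : Prog} {env : ℕ → ℕ} {μ : Memory}
    (I : ℕ → Memory → Prop) (h0 : I 0 μ)
    (hstep : ∀ k < d.val m n s, ∀ ν, I k ν →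
      I (k + 1) (body.eval g svdOracle (Function.update env v k) ν)) :
    I (d.val m n s) ((Prog.loop v d body).eval g svdOracle env μ) := by
  rw [Prog.eval]
  suffices h : ∀ N ≤ d.val m n s, I N ((List.range N).foldl
      (fun ν k => body.eval g svdOracle (Function.update env v k) ν) μ) from h _ le_rfl
  intro N
  induction N with
  | zero => exact fun _ => h0
  | succ N ih =>
    intro hN
    rw [List.range_succ, List.foldl_append]
    exact hstep N hN _ (ih (by omega))

/-- A double loop over rows and columns whose body updates the entry `(i, j)` of the array `dst`,
possibly using the array `tmp` as scratch space. -/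
theorem Prog.eval_loop_loop {body : Prog} {dst tmp : ℕ} {μ : Memory} (F : ℝ → ℕ → ℕ → ℝ)
    (hbody : ∀ env : ℕ → ℕ, env 0 < m → env 1 < n → ∀ ν : Memory,
      (∀ a, a ≠ dst → a ≠ tmp → ν a = μ a) →
      (∀ a, a ≠ dst → a ≠ tmp → body.eval g svdOracle env ν a = μ a) ∧
      (∀ i j, ¬(i = env 0 ∧ j = env 1) → body.eval g svdOracle env ν dst i j = ν dst i j) ∧
      body.eval g svdOracle env ν dst (env 0) (env 1) = F (ν dst (env 0) (env 1)) (env 0) (env 1))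
    (env : ℕ → ℕ) :
    (∀ a, a ≠ dst → a ≠ tmp →
      (Prog.loop 0 .rows (.loop 1 .cols body)).eval g svdOracle env μ a = μ a) ∧
    ∀ i < m, ∀ j < n,
      (Prog.loop 0 .rows (.loop 1 .cols body)).eval g svdOracle env μ dst i j =
        F (μ dst i j) i j := by
  have key := Prog.eval_loop_induction g svdOracle (v := 0) (d := .rows)
    (body := .loop 1 .cols body) (env := env) (μ := μ)
    (fun k ν => (∀ a, a ≠ dst → a ≠ tmp → ν a = μ a) ∧ ∀ i j, ν dst i j =
      if i < k ∧ j < n then F (μ dst i j) i j else μ dst i j)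
    ⟨fun _ _ _ => rfl, by simp⟩ ?_
  · refine ⟨key.1, fun i hi j hj => ?_⟩
    rw [key.2 i j, if_pos ⟨hi, hj⟩]
  intro k hk ν hν
  have inner := Prog.eval_loop_induction g svdOracle (v := 1) (d := .cols)
    (body := body) (env := Function.update env 0 k) (μ := ν)
    (fun l ξ => (∀ a, a ≠ dst → a ≠ tmp → ξ a = μ a) ∧ ∀ i j, ξ dst i j =
      if (i < k ∧ j < n) ∨ (i = k ∧ j < l) then F (μ dst i j) i j else μ dst i j)
    ⟨hν.1, by simpa using hν.2⟩ ?_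
  · refine ⟨inner.1, fun i j => ?_⟩
    rw [inner.2 i j]
    refine if_congr ?_ rfl rfl
    change (i < k ∧ j < n) ∨ (i = k ∧ j < n) ↔ i < k + 1 ∧ j < n
    omega
  intro l hl ξ hξ
  obtain ⟨h1, h2, h3⟩ := hbody (Function.update (Function.update env 0 k) 1 l) hk hl ξ hξ.1
  refine ⟨h1, fun i j => ?_⟩
  have e0 : Function.update (Function.update env 0 k) 1 l 0 = k := rfl
  have e1 : Function.update (Function.update env 0 k) 1 l 1 = l := rfl
  rw [e0, e1] at h2 h3
  by_cases hij : i = k ∧ j = l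
  · obtain ⟨rfl, rfl⟩ := hij
    rw [h3, hξ.2, if_neg (by omega), if_pos (by omega)]
  · rw [h2 i j hij, hξ.2]
    exact if_congr (by omega) rfl rfl

end Semantics

/-! ### The program for one iteration -/

section Program

open Matrix

variable {m n s : ℕ}

/-- The corner cell of array `a`, which serves as a scalar register. -/
def reg (a : ℕ) : Cell := ⟨a, .lit 0, .lit 0⟩

/-- The entry of array `a` at the current row (loop variable `0`) and column (loop variable `1`). -/
def entry (a : ℕ) : Cell := ⟨a, .var 0, .var 1⟩

/-- The `j`-th cell of the parameter array, which holds `R, s, β, η`. -/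
def param (j : ℕ) : Cell := ⟨1, .lit 0, .lit j⟩

/-- `dst := U diag(σ) Vᵀ`, with register `11` as scratch space. -/
def composeProg (U σ V dst : ℕ) : Prog :=
  .loop 0 .rows (.loop 1 .cols (.seq (.const (entry dst) 0) (.loop 2 .rank
    (.seq (.arith .mul (reg 11) ⟨U, .var 0, .var 2⟩ ⟨σ, .lit 0, .var 2⟩)
    (.seq (.arith .mul (reg 11) (reg 11) ⟨V, .var 1, .var 2⟩)
      (.arith .add (entry dst) (entry dst) (reg 11)))))))

/-- Register `12 := 4 s β η`. -/
def scaleProg : Prog :=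
  .seq (.const (reg 12) 4)
  (.seq (.arith .mul (reg 12) (reg 12) (param 1))
  (.seq (.arith .mul (reg 12) (reg 12) (param 2))
    (.arith .mul (reg 12) (reg 12) (param 3))))

/-- Array `6` minus array `2` divided by register `12`, entrywise. -/
def gradStepProg : Prog :=
  .loop 0 .rows (.loop 1 .cols
    (.seq (.arith .div (reg 11) (entry 2) (reg 12))
      (.arith .sub (entry 6) (entry 6) (reg 11))))

/-- Register `15` receives the scan level of row `0` of array `9`; register `13` holds the partial
sums, register `14` counts. -/
def scanProg : Prog :=
  .seq (.const (reg 13) 0)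
  (.seq (.const (reg 14) 0)
  (.seq (.const (reg 15) 0)
  (.seq (.const (reg 16) 0)
  (.seq (.const (reg 17) 1)
    (.loop 0 .rank
      (.seq (.arith .add (reg 13) (reg 13) ⟨9, .lit 0, .var 0⟩)
      (.seq (.arith .add (reg 14) (reg 14) (reg 17))
      (.seq (.arith .sub (reg 11) (reg 13) (param 0))
      (.seq (.arith .div (reg 11) (reg 11) (reg 14))
        (.ifLE (reg 15) (reg 11) (.arith .add (reg 15) (reg 11) (reg 16)) .skip))))))))))

/-- Soft-thresholding of row `0` of array `9` at the level in register `15`; register `16`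
holds `0`. -/
def thresholdProg : Prog :=
  .loop 0 .rank
    (.seq (.arith .sub ⟨9, .lit 0, .var 0⟩ ⟨9, .lit 0, .var 0⟩ (reg 15))
      (.ifLE ⟨9, .lit 0, .var 0⟩ (reg 16) (.const ⟨9, .lit 0, .var 0⟩ 0) .skip))

/-- Array `0` receives the convex combination of arrays `0` and `6` with step `η`; register `17`
holds `1`. -/
def combineProg : Prog :=
  .seq (.arith .sub (reg 18) (reg 17) (param 3))
    (.loop 0 .rows (.loop 1 .cols
      (.seq (.arith .mul (entry 0) (reg 18) (entry 0))
      (.seq (.arith .mul (reg 11) (param 3) (entry 6))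
        (.arith .add (entry 0) (entry 0) (reg 11))))))

/-- One iteration: gradient, SVD of the iterate, thresholding and gradient step, second SVD,
projection of its singular values, convex combination. Array `2` holds the gradient, arrays `3`-`5`
and `8`-`10` the two SVDs, array `6` in turn the thresholded iterate, the matrix to be projected and
its projection, and the arrays from `11` on serve as registers. -/
def iterProg : Prog :=
  .seq (.grad 0 2)
  (.seq (.svd 0 3 4 5)
  (.seq (.seq (composeProg 3 4 5 6) (.seq scaleProg gradStepProg))
  (.seq (.svd 6 8 9 10)
    (.seq scanProg (.seq thresholdProg (.seq (composeProg 8 9 10 6) combineProg))))))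

variable (g : Mat m n → Mat m n) (svdOracle : Mat m n → SVDData m n s)

theorem svd_apply (U : Mat m s) (σ : Fin s → ℝ) (V : Mat n s) (i : Fin m) (j : Fin n) :
    (U * Matrix.diagonal σ * Vᵀ) i j = ∑ l, U i l * σ l * V j l := by
  rw [mul_apply]
  simp only [mul_diagonal, transpose_apply]

theorem composeProg_eval {U σ V dst : ℕ} (hU : U ≠ dst) (hσ : σ ≠ dst) (hV : V ≠ dst)
    (hU' : U ≠ 11) (hσ' : σ ≠ 11) (hV' : V ≠ 11) (hd : dst ≠ 11) (env : ℕ → ℕ) (μ : Memory) :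
    (∀ a, a ≠ dst → a ≠ 11 → (composeProg U σ V dst).eval g svdOracle env μ a = μ a) ∧
    readMat m n ((composeProg U σ V dst).eval g svdOracle env μ) dst =
      readMat m s μ U * Matrix.diagonal (fun l : Fin s => μ σ 0 l) * (readMat n s μ V)ᵀ := by
  have h := Prog.eval_loop_loop g svdOracle (dst := dst) (tmp := 11) (μ := μ)
    (body := .seq (.const (entry dst) 0) (.loop 2 .rank
      (.seq (.arith .mul (reg 11) ⟨U, .var 0, .var 2⟩ ⟨σ, .lit 0, .var 2⟩)
      (.seq (.arith .mul (reg 11) (reg 11) ⟨V, .var 1, .var 2⟩)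
        (.arith .add (entry dst) (entry dst) (reg 11))))))
    (fun _ i j => ∑ l ∈ Finset.range s, μ U i l * μ σ 0 l * μ V j l) ?_ env
  · refine ⟨h.1, ?_⟩
    ext i j
    rw [svd_apply]
    refine (h.2 i i.isLt j j.isLt).trans ?_
    exact (Fin.sum_univ_eq_sum_range (fun l => μ U i l * μ σ 0 l * μ V j l) s).symm
  intro env hi hj ν hν
  have key := Prog.eval_loop_induction g svdOracle (v := 2) (d := .rank)
    (body := (.seq (.arith .mul (reg 11) ⟨U, .var 0, .var 2⟩ ⟨σ, .lit 0, .var 2⟩)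
      (.seq (.arith .mul (reg 11) (reg 11) ⟨V, .var 1, .var 2⟩)
        (.arith .add (entry dst) (entry dst) (reg 11)))))
    (env := env) (μ := (Prog.const (entry dst) 0).eval g svdOracle env ν)
    (fun k ξ => (∀ a, a ≠ dst → a ≠ 11 → ξ a = μ a) ∧
      (∀ i' j', ¬(i' = env 0 ∧ j' = env 1) → ξ dst i' j' = ν dst i' j') ∧
      ξ dst (env 0) (env 1) = ∑ l ∈ Finset.range k, μ U (env 0) l * μ σ 0 l * μ V (env 1) l) ?_ ?_
  · exact key
  · refine ⟨fun a h1 h2 => ?_, fun i' j' hij => ?_, ?_⟩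
    · rw [← hν a h1 h2]
      funext i' j'
      simp [Prog.eval, writeCell, entry, h1]
    · simp [Prog.eval, writeCell, entry, Idx.val, hij]
    · simp [Prog.eval, writeCell, entry, Idx.val]
  · intro k hk ξ ⟨h1, h2, h3⟩
    refine ⟨fun a ha1 ha2 => ?_, fun i' j' hij => ?_, ?_⟩
    · rw [← h1 a ha1 ha2]
      funext i' j'
      simp [Prog.eval, writeCell, entry, reg, ha1, ha2]
    · rw [← h2 i' j' hij]
      simp [Prog.eval, writeCell, entry, reg, Idx.val, hij, hd]
    · rw [Finset.sum_range_succ, ← h3]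
      simp [Prog.eval, writeCell, readCell, entry, reg, Idx.val, Arith.val, hd, hV',
        h1 U hU hU', h1 σ hσ hσ', h1 V hV hV']

theorem scaleProg_eval (env : ℕ → ℕ) (μ : Memory) :
    (∀ a, a ≠ 12 → scaleProg.eval g svdOracle env μ a = μ a) ∧
    scaleProg.eval g svdOracle env μ 12 0 0 = 4 * μ 1 0 1 * μ 1 0 2 * μ 1 0 3 := by
  constructor
  · intro a ha
    funext i j
    simp [scaleProg, Prog.eval, writeCell, reg, ha]
  · simp [scaleProg, Prog.eval, writeCell, readCell, reg, param, Idx.val, Arith.val]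

theorem gradStepProg_eval (env : ℕ → ℕ) (μ : Memory) :
    (∀ a, a ≠ 6 → a ≠ 11 → gradStepProg.eval g svdOracle env μ a = μ a) ∧
    readMat m n (gradStepProg.eval g svdOracle env μ) 6 =
      readMat m n μ 6 - (1 / μ 12 0 0) • readMat m n μ 2 := by
  have h := Prog.eval_loop_loop g svdOracle (dst := 6) (tmp := 11) (μ := μ)
    (body := .seq (.arith .div (reg 11) (entry 2) (reg 12))
      (.arith .sub (entry 6) (entry 6) (reg 11)))
    (fun r i j => r - μ 2 i j / μ 12 0 0) ?_ env
  · refine ⟨h.1, ?_⟩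
    ext i j
    refine (h.2 i i.isLt j j.isLt).trans ?_
    simp only [readMat, Matrix.sub_apply, Matrix.smul_apply, smul_eq_mul]
    ring
  intro env hi hj ν hν
  refine ⟨fun a ha1 ha2 => ?_, fun i' j' hij => ?_, ?_⟩
  · rw [← hν a ha1 ha2]
    funext i' j'
    simp [Prog.eval, writeCell, entry, reg, ha1, ha2]
  · simp [Prog.eval, writeCell, entry, reg, Idx.val, hij]
  · simp [Prog.eval, writeCell, readCell, entry, reg, Idx.val, Arith.val, hν 2, hν 12]

theorem combineProg_eval (env : ℕ → ℕ) (μ : Memory) (h17 : μ 17 0 0 = 1) :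
    (∀ a, a ≠ 0 → a ≠ 11 → a ≠ 18 → combineProg.eval g svdOracle env μ a = μ a) ∧
    readMat m n (combineProg.eval g svdOracle env μ) 0 =
      (1 - μ 1 0 3) • readMat m n μ 0 + μ 1 0 3 • readMat m n μ 6 := by
  set μ' := (Prog.arith .sub (reg 18) (reg 17) (param 3)).eval g svdOracle env μ with hμ'
  have hframe : ∀ a, a ≠ 18 → μ' a = μ a := fun a ha => by
    funext i j
    simp [hμ', Prog.eval, writeCell, reg, ha]
  have h18 : μ' 18 0 0 = 1 - μ 1 0 3 := by
    simp [hμ', Prog.eval, writeCell, readCell, reg, param, Idx.val, Arith.val, h17]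
  have h := Prog.eval_loop_loop g svdOracle (dst := 0) (tmp := 11) (μ := μ')
    (body := .seq (.arith .mul (entry 0) (reg 18) (entry 0))
      (.seq (.arith .mul (reg 11) (param 3) (entry 6))
        (.arith .add (entry 0) (entry 0) (reg 11))))
    (fun r i j => (1 - μ 1 0 3) * r + μ 1 0 3 * μ 6 i j) ?_ env
  · refine ⟨fun a h0 h11 h18 => (h.1 a h0 h11).trans (hframe a h18), ?_⟩
    ext i j
    refine (h.2 i i.isLt j j.isLt).trans ?_
    rw [hframe 0 (by norm_num)]
    rfl
  intro env hi hj ν hν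
  refine ⟨fun a ha1 ha2 => ?_, fun i' j' hij => ?_, ?_⟩
  · rw [← hν a ha1 ha2]
    funext i' j'
    simp [Prog.eval, writeCell, entry, reg, ha1, ha2]
  · simp [Prog.eval, writeCell, entry, reg, Idx.val, hij]
  · simp [Prog.eval, writeCell, readCell, entry, reg, param, Idx.val, Arith.val, hν 1, hν 6, hν 18,
      hframe 1, hframe 6, h18]

theorem scanProg_eval (env : ℕ → ℕ) (μ : Memory) :
    (∀ a, a ∉ ({11, 13, 14, 15, 16, 17} : Finset ℕ) → scanProg.eval g svdOracle env μ a = μ a) ∧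
    scanProg.eval g svdOracle env μ 16 0 0 = 0 ∧
    scanProg.eval g svdOracle env μ 17 0 0 = 1 ∧
    IsScanLevel (μ 9 0) (μ 1 0 0) s (scanProg.eval g svdOracle env μ 15 0 0) := by
  set μ' := (Prog.const (reg 17) 1).eval g svdOracle env
    ((Prog.const (reg 16) 0).eval g svdOracle env ((Prog.const (reg 15) 0).eval g svdOracle env
    ((Prog.const (reg 14) 0).eval g svdOracle env ((Prog.const (reg 13) 0).eval g svdOracle env
      μ)))) with hμ'
  have key := Prog.eval_loop_induction g svdOracle (v := 0) (d := .rank)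
    (body := .seq (.arith .add (reg 13) (reg 13) ⟨9, .lit 0, .var 0⟩)
      (.seq (.arith .add (reg 14) (reg 14) (reg 17))
      (.seq (.arith .sub (reg 11) (reg 13) (param 0))
      (.seq (.arith .div (reg 11) (reg 11) (reg 14))
        (.ifLE (reg 15) (reg 11) (.arith .add (reg 15) (reg 11) (reg 16)) .skip)))))
    (env := env) (μ := μ')
    (fun k ξ => (∀ a, a ∉ ({11, 13, 14, 15, 16, 17} : Finset ℕ) → ξ a = μ a) ∧
      ξ 13 0 0 = ∑ i ∈ Finset.range k, μ 9 0 i ∧ ξ 14 0 0 = k ∧ ξ 16 0 0 = 0 ∧ ξ 17 0 0 = 1 ∧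
      IsScanLevel (μ 9 0) (μ 1 0 0) k (ξ 15 0 0)) ?_ ?_
  · obtain ⟨h1, -, -, h2, h3, h4⟩ := key
    exact ⟨h1, h2, h3, h4⟩
  · refine ⟨fun a ha => ?_, ?_, ?_, ?_, ?_, ?_⟩
    · simp only [Finset.mem_insert, Finset.mem_singleton, not_or] at ha
      funext i j
      simp [hμ', Prog.eval, writeCell, reg, ha]
    · simp [hμ', Prog.eval, writeCell, reg, Idx.val]
    · simp [hμ', Prog.eval, writeCell, reg, Idx.val]
    · simp [hμ', Prog.eval, writeCell, reg, Idx.val]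
    · simp [hμ', Prog.eval, writeCell, reg, Idx.val]
    · have : μ' 15 0 0 = 0 := by simp [hμ', Prog.eval, writeCell, reg, Idx.val]
      rw [this]
      exact isScanLevel_zero _ _
  · intro k hk ξ ⟨h1, h13, h14, h16, h17, h15⟩
    have h9 : ξ 9 = μ 9 := h1 9 (by decide)
    have hp : ξ 1 = μ 1 := h1 1 (by decide)
    have hstep := h15.succ
    refine ⟨fun a ha => ?_, ?_, ?_, ?_, ?_, ?_⟩
    · rw [← h1 a ha]
      simp only [Finset.mem_insert, Finset.mem_singleton, not_or] at ha
      funext i j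
      simp [Prog.eval, writeCell, reg, ha]
    · rw [Finset.sum_range_succ, ← h13]
      simp [Prog.eval, writeCell, readCell, reg, Idx.val, Arith.val, h9]
    · simp only [Prog.eval]
      split_ifs <;> simp [writeCell, readCell, reg, Idx.val, Arith.val, h14, h17]
    · simp only [Prog.eval]
      split_ifs <;> simp [writeCell, reg, Idx.val, h16]
    · simp only [Prog.eval]
      split_ifs <;> simp [writeCell, reg, Idx.val, h17]
    · convert hstep using 1
      rw [Finset.sum_range_succ]
      simp [Prog.eval, writeCell, readCell, reg, param, Idx.val, Arith.val, h9, hp, h13, h14,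
        h16, h17]

theorem thresholdProg_eval (env : ℕ → ℕ) (μ : Memory) (h16 : μ 16 0 0 = 0) :
    (∀ a, a ≠ 9 → thresholdProg.eval g svdOracle env μ a = μ a) ∧
    ∀ j < s, thresholdProg.eval g svdOracle env μ 9 0 j = max (μ 9 0 j - μ 15 0 0) 0 := by
  have key := Prog.eval_loop_induction g svdOracle (v := 0) (d := .rank)
    (body := .seq (.arith .sub ⟨9, .lit 0, .var 0⟩ ⟨9, .lit 0, .var 0⟩ (reg 15))
      (.ifLE ⟨9, .lit 0, .var 0⟩ (reg 16) (.const ⟨9, .lit 0, .var 0⟩ 0) .skip))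
    (env := env) (μ := μ)
    (fun k ξ => (∀ a, a ≠ 9 → ξ a = μ a) ∧
      ∀ j, ξ 9 0 j = if j < k then max (μ 9 0 j - μ 15 0 0) 0 else μ 9 0 j) ?_ ?_
  · exact ⟨key.1, fun j hj => (key.2 j).trans (if_pos hj)⟩
  · exact ⟨fun _ _ => rfl, by simp⟩
  · intro k hk ξ ⟨h1, h9⟩
    refine ⟨fun a ha => ?_, fun j => ?_⟩
    · rw [← h1 a ha]
      funext i j
      simp [Prog.eval, writeCell, ha]
    · have hk9 : ξ 9 0 k = μ 9 0 k := by rw [h9, if_neg (lt_irrefl k)]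
      by_cases hj : j = k
      · subst hj
        rw [if_pos (Nat.lt_succ_self j)]
        simp [Prog.eval, writeCell, readCell, reg, Idx.val, Arith.val, h1 15, h1 16, h16, hk9]
        split_ifs with hle
        · simp [hle]
        · simp [(not_le.mp hle).le]
      · have : (j < k + 1) = (j < k) := by simp only [eq_iff_iff]; omega
        simp only [this]
        rw [← h9]
        simp [Prog.eval, writeCell, Idx.val, hj]

end Program

/-! ### Correctness and cost of one iteration -/

section Iteration

open Matrix

variable {m n s : ℕ}

theorem readMat_congr {p q : ℕ} {μ ν : Memory} {a : ℕ} (h : μ a = ν a) :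
    readMat p q μ a = readMat p q ν a := by
  ext i j
  exact congrFun₂ h i j

theorem writeMat_of_ne {p q : ℕ} (μ : Memory) {a b : ℕ} (M : Mat p q) (h : b ≠ a) :
    writeMat μ a M b = μ b := by
  funext i j
  simp [writeMat, h]

theorem writeMat_self {p q : ℕ} (μ : Memory) (a : ℕ) (M : Mat p q) {i j : ℕ} (hi : i < p)
    (hj : j < q) : writeMat μ a M a i j = M ⟨i, hi⟩ ⟨j, hj⟩ := by
  simp [writeMat, hi, hj]

theorem readMat_writeMat {p q : ℕ} (μ : Memory) (a : ℕ) (M : Mat p q) :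
    readMat p q (writeMat μ a M) a = M := by
  ext i j
  exact writeMat_self μ a M i.isLt j.isLt

theorem writeSVD_eq (μ : Memory) (aU aσ aV : ℕ) (D : SVDData m n s) :
    writeSVD μ aU aσ aV D =
      writeMat (writeMat (writeMat μ aU D.U) aσ (Matrix.of fun (_ : Fin 1) j => D.σ j)) aV D.V :=
  rfl

theorem writeSVD_spec (μ : Memory) {aU aσ aV : ℕ} (h1 : aU ≠ aσ) (h2 : aU ≠ aV) (h3 : aσ ≠ aV)
    (D : SVDData m n s) :
    (∀ a, a ≠ aU → a ≠ aσ → a ≠ aV → writeSVD μ aU aσ aV D a = μ a) ∧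
    readMat m s (writeSVD μ aU aσ aV D) aU = D.U ∧
    (∀ l : Fin s, writeSVD μ aU aσ aV D aσ 0 l = D.σ l) ∧
    readMat n s (writeSVD μ aU aσ aV D) aV = D.V := by
  refine ⟨fun a hU hσ hV => ?_, ?_, fun l => ?_, readMat_writeMat _ _ _⟩
  · rw [writeSVD_eq, writeMat_of_ne _ _ hV, writeMat_of_ne _ _ hσ, writeMat_of_ne _ _ hU]
  · rw [writeSVD_eq, readMat_congr (writeMat_of_ne _ _ h2), readMat_congr (writeMat_of_ne _ _ h1),
      readMat_writeMat]
  · rw [writeSVD_eq, writeMat_of_ne _ _ h3, writeMat_self _ _ _ zero_lt_one l.isLt]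
    rfl

/-- One execution of the program performs one iteration of the algorithm and keeps the
parameters. -/
theorem iterProg_eval {g : Mat m n → Mat m n} {svdOracle : Mat m n → SVDData m n s}
    {hs : s ≤ min m n} (ho : ∀ Z, IsTopSVD hs Z (svdOracle Z)) {R β η : ℝ} (hR : 0 ≤ R)
    (hc : 0 < 4 * s * β * η) (env : ℕ → ℕ) {μ : Memory} {X : Mat m n}
    (hμ : Loaded μ X R s β η) :
    ∃ xhat ∈ argminOn (fun y => frobNorm (y - X)) (lowRank m n s),
      ∃ v ∈ argminOn (fun w => dot (w - X) (g X) + 2 * s * β * η * frobNorm (w - xhat) ^ 2)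
        (nuclearBall m n R ∩ lowRank m n s),
        Loaded (iterProg.eval g svdOracle env μ) ((1 - η) • X + η • v) R s β η := by
  obtain ⟨hX, hRc, hsc, hβc, hηc⟩ := hμ
  -- `μ₁`, …, `μ₉` are the successive memories; `fᵢ` says which arrays the `i`-th step keeps
  set μ₁ := writeMat μ 2 (g (readMat m n μ 0)) with hμ₁
  have f₁ : ∀ a, a ≠ 2 → μ₁ a = μ a := fun a ha => writeMat_of_ne _ _ ha
  have hG : readMat m n μ₁ 2 = g X := by rw [hμ₁, readMat_writeMat, hX]
  have hX₁ : readMat m n μ₁ 0 = X := (readMat_congr (f₁ 0 (by decide))).trans hX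
  set D := svdOracle (readMat m n μ₁ 0) with hD
  set μ₂ := writeSVD μ₁ 3 4 5 D with hμ₂
  obtain ⟨f₂, hU₂, hσ₂, hV₂⟩ := writeSVD_spec μ₁ (aU := 3) (aσ := 4) (aV := 5)
    (by decide) (by decide) (by decide) D
  rw [← hμ₂] at f₂ hU₂ hσ₂ hV₂
  have hDX : IsTopSVD hs X D := by rw [hD, hX₁]; exact ho X
  set μ₃ := (composeProg 3 4 5 6).eval g svdOracle env μ₂ with hμ₃
  obtain ⟨f₃, hW₃⟩ := composeProg_eval g svdOracle (U := 3) (σ := 4) (V := 5) (dst := 6)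
    (by decide) (by decide) (by decide) (by decide) (by decide) (by decide) (by decide) env μ₂
  rw [← hμ₃] at f₃ hW₃
  rw [hU₂, hV₂, funext hσ₂] at hW₃
  set xhat := D.U * Matrix.diagonal D.σ * D.Vᵀ with hxhat
  have hxmem : xhat ∈ argminOn (fun y => frobNorm (y - X)) (lowRank m n s) :=
    hDX.mem_argminOn_frobNorm
  set μ₄ := scaleProg.eval g svdOracle env μ₃ with hμ₄
  obtain ⟨f₄, hc₄⟩ := scaleProg_eval g svdOracle env μ₃
  rw [← hμ₄] at f₄ hc₄
  have p₃ : μ₃ 1 = μ 1 := by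
    rw [f₃ 1 (by decide) (by decide), f₂ 1 (by decide) (by decide) (by decide), f₁ 1 (by decide)]
  rw [p₃, hsc, hβc, hηc] at hc₄
  set μ₅ := gradStepProg.eval g svdOracle env μ₄ with hμ₅
  obtain ⟨f₅, hZ₅⟩ := gradStepProg_eval g svdOracle env μ₄
  rw [← hμ₅] at f₅ hZ₅
  have hG₄ : readMat m n μ₄ 2 = g X := by
    rw [← hG]
    refine readMat_congr ?_
    rw [f₄ 2 (by decide), f₃ 2 (by decide) (by decide), f₂ 2 (by decide) (by decide) (by decide)]
  rw [hc₄, hG₄, readMat_congr (f₄ 6 (by decide)), hW₃] at hZ₅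
  -- from here on array `6` holds the matrix whose projection is the proximal step
  set E := svdOracle (readMat m n μ₅ 6) with hE
  set μ₆ := writeSVD μ₅ 8 9 10 E with hμ₆
  obtain ⟨f₆, hU₆, hσ₆, hV₆⟩ := writeSVD_spec μ₅ (aU := 8) (aσ := 9) (aV := 10)
    (by decide) (by decide) (by decide) E
  rw [← hμ₆] at f₆ hU₆ hσ₆ hV₆
  have hEZ : IsTopSVD hs (xhat - (1 / (4 * s * β * η)) • g X) E := by rw [hE, hZ₅]; exact ho _
  set μ₇ := scanProg.eval g svdOracle env μ₆ with hμ₇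
  obtain ⟨f₇, hz₇, ho₇, hτ₇⟩ := scanProg_eval g svdOracle env μ₆
  rw [← hμ₇] at f₇ hz₇ ho₇ hτ₇
  have p₆ : μ₆ 1 = μ 1 := by
    rw [f₆ 1 (by decide) (by decide) (by decide), f₅ 1 (by decide) (by decide),
      f₄ 1 (by decide), p₃]
  rw [p₆, hRc] at hτ₇
  set μ₈ := thresholdProg.eval g svdOracle env μ₇ with hμ₈
  obtain ⟨f₈, hσ₈⟩ := thresholdProg_eval g svdOracle env μ₇ hz₇
  rw [← hμ₈] at f₈ hσ₈
  rw [f₇ 9 (by decide)] at hσ₈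
  set μ₉ := (composeProg 8 9 10 6).eval g svdOracle env μ₈ with hμ₉
  obtain ⟨f₉, hW₉⟩ := composeProg_eval g svdOracle (U := 8) (σ := 9) (V := 10) (dst := 6)
    (by decide) (by decide) (by decide) (by decide) (by decide) (by decide) (by decide) env μ₈
  rw [← hμ₉] at f₉ hW₉
  rw [readMat_congr ((f₈ 8 (by decide)).trans (f₇ 8 (by decide))),
    readMat_congr ((f₈ 10 (by decide)).trans (f₇ 10 (by decide))), hU₆, hV₆,
    funext fun l : Fin s => hσ₈ l l.isLt] at hW₉
  have hvmem := hEZ.mem_argminOn_prox hc hR (X := X) hσ₆ hτ₇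
  rw [← hW₉, show 4 * s * β * η / 2 = 2 * s * β * η by ring] at hvmem
  -- neither the iterate nor the parameters have been overwritten so far
  have p₈ : ∀ a, a ∉ ({2, 3, 4, 5, 6, 8, 9, 10, 11, 12, 13, 14, 15, 16, 17} : Finset ℕ) →
      μ₉ a = μ a := fun a ha => by
    simp only [Finset.mem_insert, Finset.mem_singleton, not_or] at ha
    rw [f₉ a (by tauto) (by tauto), f₈ a (by tauto), f₇ a (by simp; tauto),
      f₆ a (by tauto) (by tauto) (by tauto), f₅ a (by tauto) (by tauto), f₄ a (by tauto),
      f₃ a (by tauto) (by tauto), f₂ a (by tauto) (by tauto) (by tauto), f₁ a (by tauto)]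
  have h17 : μ₉ 17 0 0 = 1 := by
    rw [f₉ 17 (by decide) (by decide), f₈ 17 (by decide), ho₇]
  obtain ⟨f, hfin⟩ := combineProg_eval g svdOracle env μ₉ h17
  rw [p₈ 1 (by decide), hηc, readMat_congr (p₈ 0 (by decide)), hX] at hfin
  have p : combineProg.eval g svdOracle env μ₉ 1 = μ 1 :=
    (f 1 (by decide) (by decide) (by decide)).trans (p₈ 1 (by decide))
  refine ⟨xhat, hxmem, _, hvmem, hfin, ?_⟩
  change combineProg.eval g svdOracle env μ₉ 1 0 0 = R ∧
    combineProg.eval g svdOracle env μ₉ 1 0 1 = s ∧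
    combineProg.eval g svdOracle env μ₉ 1 0 2 = β ∧ combineProg.eval g svdOracle env μ₉ 1 0 3 = η
  rw [p]
  exact ⟨hRc, hsc, hβc, hηc⟩

theorem iterProg_oracle_calls (g : Mat m n → Mat m n) (svdOracle : Mat m n → SVDData m n s)
    (μ : Memory) :
    (iterProg.run g svdOracle μ).grads = 1 ∧ (iterProg.run g svdOracle μ).svds = 2 := by
  have h1 : (Prog.seq (composeProg 3 4 5 6) (.seq scaleProg gradStepProg)).OracleFree := by
    simp [Prog.OracleFree, composeProg, scaleProg, gradStepProg]
  have h2 : (Prog.seq scanProg (.seq thresholdProg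
      (.seq (composeProg 8 9 10 6) combineProg))).OracleFree := by
    simp [Prog.OracleFree, composeProg, scanProg, thresholdProg, combineProg]
  have e1 := fun st => h1.exec g svdOracle (fun _ => 0) st
  have e2 := fun st => h2.exec g svdOracle (fun _ => 0) st
  rw [Prog.run, iterProg]
  generalize Prog.seq (composeProg 3 4 5 6) (.seq scaleProg gradStepProg) = p at e1
  generalize Prog.seq scanProg (.seq thresholdProg (.seq (composeProg 8 9 10 6) combineProg)) = q
    at e2
  simp only [Prog.exec]
  constructor
  · rw [(e2 _).1]
    simp only
    rw [(e1 _).1]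
  · rw [(e2 _).2]
    simp only
    rw [(e1 _).2]

theorem iterProg_cost_le (hm : 1 ≤ m) (hn : 1 ≤ n) (hs : 1 ≤ s) :
    iterProg.cost m n s ≤ 100 * (s * m * n) := by
  have hmn : m * n ≤ s * m * n := by
    rw [mul_assoc]; exact Nat.le_mul_of_pos_left _ hs
  have hm' : m ≤ s * m * n := (Nat.le_mul_of_pos_right m hn).trans hmn
  have hs' : s ≤ s * m * n := by
    rw [mul_assoc]; exact Nat.le_mul_of_pos_right s (Nat.mul_pos hm hn)
  have h1 : 1 ≤ s * m * n := hs.trans hs'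
  simp only [iterProg, composeProg, scaleProg, gradStepProg, scanProg, thresholdProg, combineProg,
    Prog.cost, Bound.val]
  nlinarith

theorem run_mem (g : Mat m n → Mat m n) (svdOracle : Mat m n → SVDData m n s) (p : Prog)
    (μ : Memory) : (p.run g svdOracle μ).mem = p.eval g svdOracle (fun _ => 0) μ :=
  p.mem_exec g svdOracle _ _

theorem loaded_memAfter {g : Mat m n → Mat m n} {svdOracle : Mat m n → SVDData m n s}
    {hs : s ≤ min m n} (ho : ∀ Z, IsTopSVD hs Z (svdOracle Z)) {R β η : ℝ} (hR : 0 ≤ R)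
    (hc : 0 < 4 * s * β * η) {μ : Memory} {X : Mat m n} (hμ : Loaded μ X R s β η) (k : ℕ) :
    Loaded (iterProg.memAfter g svdOracle μ k)
      (readMat m n (iterProg.memAfter g svdOracle μ k) 0) R s β η := by
  induction k with
  | zero => exact ⟨rfl, hμ.2⟩
  | succ k ih =>
    obtain ⟨-, -, v, -, h⟩ := iterProg_eval ho hR hc (fun _ => 0) ih
    rw [Prog.memAfter, Function.iterate_succ_apply', run_mem]
    exact ⟨rfl, h.2⟩

theorem exists_isRun_iterProg {g : Mat m n → Mat m n} {svdOracle : Mat m n → SVDData m n s}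
    {hs : s ≤ min m n} (ho : ∀ Z, IsTopSVD hs Z (svdOracle Z)) {R β η : ℝ} (hR : 0 ≤ R)
    (hc : 0 < 4 * s * β * η) (hη : η ∈ Icc (0 : ℝ) 1) {μ : Memory} {X : Mat m n}
    (hX : X ∈ nuclearBall m n R) (hμ : Loaded μ X R s β η) :
    ∃ xhat v : ℕ → Mat m n, IsRun g (nuclearBall m n R) (lowRank m n s) s β η
      (fun k => readMat m n (iterProg.memAfter g svdOracle μ k) 0) xhat v (fun _ => η) := by
  have h := fun k =>
    iterProg_eval (g := g) ho hR hc (fun _ => 0) (loaded_memAfter (g := g) ho hR hc hμ k)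
  choose xhat hxhat v hv hnext using h
  refine ⟨xhat, v, ?_, hxhat, hv, fun _ => hη, fun k => ?_⟩
  · exact hμ.1.symm ▸ hX
  · refine Eq.trans ?_ (hnext k).1
    simp only [Prog.memAfter, Function.iterate_succ_apply', run_mem]

end Iteration

end SparseFW

theorem corollary2 :
    ∃ (C₁ C₂ : ℝ) (prog : SparseFW.Prog),
      ∀ (m n s : ℕ) (f : SparseFW.Mat m n → ℝ) (g : SparseFW.Mat m n → SparseFW.Mat m n)
        (R β α₂ : ℝ) (hP : SparseFW.NuclearProblem s f g R β α₂),
        -- the structural assumption holds with constants `s` and `8 s`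
        SparseFW.SparsityAssumption SparseFW.nuclearNorm SparseFW.frobNorm
          (SparseFW.nuclearBall m n R) (SparseFW.argminOn f (SparseFW.nuclearBall m n R))
          (SparseFW.lowRank m n s) (s : ℝ) (8 * s) ∧
        ∀ η : ℝ, η = SparseFW.stepSize s (8 * s) β α₂ → η ≤ 1 →
          -- iteration complexity of every run of the algorithm
          (∀ (x xhat v : ℕ → SparseFW.Mat m n) (γ : ℕ → ℝ),
            SparseFW.IsRun g (SparseFW.nuclearBall m n R) (SparseFW.lowRank m n s) s β η
              x xhat v γ →
            SparseFW.StepRule f η x v γ →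
            ∀ ε : ℝ, 0 < ε →
              (∀ k : ℕ, C₁ * (β * s / α₂) *
                  Real.log ((f (x 0) - SparseFW.optVal f (SparseFW.nuclearBall m n R)) / ε) ≤ k →
                f (x k) - SparseFW.optVal f (SparseFW.nuclearBall m n R) ≤ ε) ∧
              (ε * (f (x 0) - SparseFW.optVal f (SparseFW.nuclearBall m n R)) ≤ 1 →
                ∀ k : ℕ, C₁ * (β * s / α₂) * Real.log (1 / ε) ≤ k →
                f (x k) - SparseFW.optVal f (SparseFW.nuclearBall m n R) ≤ ε)) ∧
          -- implementation with two rank-`s` SVDs per iteration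
          (∀ svdOracle : SparseFW.Mat m n → SparseFW.SVDData m n s,
            (∀ Z, SparseFW.IsTopSVD hP.s_le Z (svdOracle Z)) →
            ∀ X₀ ∈ SparseFW.nuclearBall m n R, ∀ mem : SparseFW.Memory,
              SparseFW.Loaded mem X₀ R s β η →
              SparseFW.readMat m n (prog.memAfter g svdOracle mem 0) 0 = X₀ ∧
              (∃ xhat v : ℕ → SparseFW.Mat m n,
                SparseFW.IsRun g (SparseFW.nuclearBall m n R) (SparseFW.lowRank m n s) s β η
                  (fun k => SparseFW.readMat m n (prog.memAfter g svdOracle mem k) 0)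
                  xhat v (fun _ => η)) ∧
              ∀ k : ℕ,
                (prog.run g svdOracle (prog.memAfter g svdOracle mem k)).grads = 1 ∧
                (prog.run g svdOracle (prog.memAfter g svdOracle mem k)).svds = 2 ∧
                ((prog.run g svdOracle (prog.memAfter g svdOracle mem k)).ops : ℝ) ≤
                  C₂ * (s * m * n)) := by
  refine ⟨256, 100, SparseFW.iterProg, fun m n s f g R β α₂ hP =>
    ⟨hP.sparsityAssumption, fun η hη hη1 => ⟨fun x xhat v γ hrun hstep ε hε =>
      hP.iteration_complexity hη hη1 hrun hstep hε, fun svdOracle ho X₀ hX₀ mem hmem => ?_⟩⟩⟩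
  have hη0 : 0 < η := hη ▸ hP.stepSize_pos
  have hβ := hP.β_pos
  have hs0 : (0 : ℝ) < s := by exact_mod_cast hP.one_le_s
  have hc : 0 < 4 * s * β * η := by positivity
  refine ⟨hmem.1, SparseFW.exists_isRun_iterProg ho hP.R_nonneg hc ⟨hη0.le, hη1⟩ hX₀ hmem,
    fun k => ?_⟩
  set μ := SparseFW.iterProg.memAfter g svdOracle mem k
  obtain ⟨h1, h2⟩ := SparseFW.iterProg_oracle_calls g svdOracle μ
  refine ⟨h1, h2, ?_⟩
  have h3 : (SparseFW.iterProg.run g svdOracle μ).ops ≤ 0 + SparseFW.iterProg.cost m n s :=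
    SparseFW.iterProg.ops_exec_le g svdOracle (fun _ => 0) ⟨μ, 0, 0, 0⟩
  have hm := (hP.one_le_s.trans hP.s_le).trans (min_le_left m n)
  have hn := (hP.one_le_s.trans hP.s_le).trans (min_le_right m n)
  have h4 := SparseFW.iterProg_cost_le hm hn hP.one_le_s
  rw [zero_add] at h3
  exact_mod_cast h3.trans h4
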